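/- Throughout, a distribution on $\mathbb{R}^d$ is a Borel probability measure $\mu$ on $\mathbb{R}^d$, with characteristic function $\widehat\mu(z)=\int_{\mathbb{R}^d} e^{\mathrm{i}\langle z,x\rangle}\,\mu(\mathrm{d}x)$. A distribution is infinitely divisible if for every integer $n\ge 1$ it is the $n$-fold convolution of some distribution with itself. A distribution $\mu$ is quasi-infinitely divisible if $\widehat\mu(z)=\widehat\mu_1(z)/\widehat\mu_2(z)$ for all $z\in\mathbb{R}^d$, with infinitely divisible distributions $\mu_1,\mu_2$. A quasi-Lévy type measure is a function $\nu$, real-valued and defined on the Borel sets that are bounded away from $0$, whose restriction to the Borel subsets of $\{|x|\ge r\}$ is a finite signed measure for every $r>0$, and which satisfies $\int_{\mathbb{R}^d} (1\wedge|x|^2)\,|\nu|(\mathrm{d}x)<\infty$. Here $\nu^+$, $\nu^-$ and $|\nu|=\nu^++\nu^-$ are the measures on $\mathbb{R}^d$ that do not charge $\{0\}$ and that agree on the Borel subsets of $\{|x|\ge r\}$, for every $r>0$, with the positive part, the negative part and the total variation of the restriction of $\nu$; integrals with respect to $\nu$ are $\int f\,\mathrm{d}\nu=\int f\,\mathrm{d}\nu^+-\int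 f\,\mathrm{d}\nu^-$. A characteristic triplet of a distribution $\mu$ is a triplet $(A,\nu,\gamma)$ of a symmetric matrix $A\in\mathbb{R}^{d\times d}$ (the Gaussian covariance matrix), a quasi-Lévy type measure $\nu$ (the quasi-Lévy measure of $\mu$) and $\gamma\in\mathbb{R}^d$ such that for all $z\in\mathbb{R}^d$ $$\widehat\mu(z)=\exp\Big(\mathrm{i}\langle\gamma,z\rangle-\tfrac12\langle z,Az\rangle+\int_{\mathbb{R}^d}\big(e^{\mathrm{i}\langle z,x\rangle}-1-\mathrm{i}\langle z,x\rangle\mathbf 1_{[0,1]}(|x|)\big)\,\nu(\mathrm{d}x)\Big).$$ If $\int_{|x|\le1}|x|\,|\nu|(\mathrm{d}x)<\infty$, the drift of $\mu$ is $\gamma-\int_{|x|\le 1}x\,\nu(\mathrm{d}x)$. **Corollary.** Let $M\in\mathbb{R}^{d\times d}$ be invertible, let $b\in\mathbb{R}^d$, and let $\mu$ be a distribution on $\mathbb{R}^d$ supported in the lattice $M\mathbb{Z}^d+b=\{Mk+b:k\in\mathbb{Z}^d\}$. Then $\mu$ is quasi-infinitely divisible if and only if $\widehat\mu$ has no zeroes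 on $(M^T)^{-1}([0,2\pi]^d)=\{(M^T)^{-1}x:x\in[0,2\pi]^d\}$. In that case $\mu$ has exactly one characteristic triplet $(A,\nu,\gamma)$, and it satisfies: $A=0$; $\nu$ is finite, that is, $|\nu|(\mathbb{R}^d)<\infty$; $\nu$ is supported in $M\mathbb{Z}^d\setminus\{0\}$, that is, $|\nu|$ of the complement of this set is $0$; and the drift of $\mu$ exists and lies in $M\mathbb{Z}^d+b$. -/

import Mathlib

open MeasureTheory Set
open scoped ENNReal

noncomputable section

namespace QuasiID

variable {d : ℕ}

/-! ### Infinite divisibility and quasi-infinite divisibility -/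

/-- The `n`-fold convolution of a measure with itself (the Dirac measure at `0` for `n = 0`). -/
def convPow (μ : Measure (EuclideanSpace ℝ (Fin d))) : ℕ → Measure (EuclideanSpace ℝ (Fin d))
  | 0 => Measure.dirac 0
  | n + 1 => (convPow μ n).conv μ

/-- A probability distribution is infinitely divisible if for every `n ≥ 1` it is the `n`-fold
convolution of some probability distribution with itself. -/
def IsInfinitelyDivisible (μ : Measure (EuclideanSpace ℝ (Fin d))) : Prop :=
  IsProbabilityMeasure μ ∧
    ∀ n : ℕ, 1 ≤ n → ∃ ρ : Measure (EuclideanSpace ℝ (Fin d)),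
      IsProbabilityMeasure ρ ∧ convPow ρ n = μ

/-- A probability distribution is quasi-infinitely divisible if its characteristic function is
the quotient of the characteristic functions of two infinitely divisible distributions (the
denominator never vanishes, because characteristic functions of infinitely divisible
distributions have no zeroes). -/
def IsQuasiInfinitelyDivisible (μ : Measure (EuclideanSpace ℝ (Fin d))) : Prop :=
  IsProbabilityMeasure μ ∧
    ∃ μ₁ μ₂ : Measure (EuclideanSpace ℝ (Fin d)),
      IsInfinitelyDivisible μ₁ ∧ IsInfinitelyDivisible μ₂ ∧
        ∀ z, charFun μ z = charFun μ₁ z / charFun μ₂ z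

/-! ### Quasi-Lévy type measures -/

/-- `AwayFromZero r B`: the set `B` is Borel and contained in `{x | r ≤ |x|}`. -/
def AwayFromZero (r : ℝ) (B : Set (EuclideanSpace ℝ (Fin d))) : Prop :=
  MeasurableSet B ∧ B ⊆ {x | r ≤ ‖x‖}

/-- A real function on the Borel sets that are bounded away from `0`, whose restriction to the
Borel subsets of `{x | r ≤ |x|}` is a finite signed measure for every `r > 0`. As for Mathlib's
vector measures, the function is given the value `0` outside its domain of definition. -/
structure PuncturedSignedMeasure (d : ℕ) where
  /-- the values -/
  toFun : Set (EuclideanSpace ℝ (Fin d)) → ℝ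
  /-- the value of the empty set is zero -/
  empty' : toFun ∅ = 0
  /-- the value is the default zero outside the domain of definition -/
  eq_zero' : ∀ B, (¬ ∃ r : ℝ, 0 < r ∧ AwayFromZero r B) → toFun B = 0
  /-- σ-additivity on the Borel subsets of `{x | r ≤ |x|}` -/
  hasSum' : ∀ r : ℝ, 0 < r → ∀ f : ℕ → Set (EuclideanSpace ℝ (Fin d)),
    (∀ i, AwayFromZero r (f i)) → Pairwise (Function.onFun Disjoint f) →
      HasSum (fun i => toFun (f i)) (toFun (⋃ i, f i))

lemma measurableSet_ge (r : ℝ) :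
    MeasurableSet {x : EuclideanSpace ℝ (Fin d) | r ≤ ‖x‖} :=
  measurableSet_le measurable_const measurable_norm

/-- The annulus of all `x ≠ 0` with `1 / (n + 1) < |x| ≤ 1 / n` (no upper bound for `n = 0`). -/
def shell (d n : ℕ) : Set (EuclideanSpace ℝ (Fin d)) :=
  {x | x ≠ 0 ∧ ⌊‖x‖⁻¹⌋₊ = n}

lemma measurableSet_shell (n : ℕ) : MeasurableSet (shell d n) := by
  have h1 : MeasurableSet {x : EuclideanSpace ℝ (Fin d) | x ≠ 0} :=
    (measurableSet_singleton (0 : EuclideanSpace ℝ (Fin d))).compl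
  have h2 : Measurable fun x : EuclideanSpace ℝ (Fin d) => ⌊‖x‖⁻¹⌋₊ :=
    Nat.measurable_floor.comp measurable_norm.inv
  exact h1.inter (h2 (measurableSet_singleton n))

lemma shell_subset (n : ℕ) : shell d n ⊆ {x | ((n : ℝ) + 1)⁻¹ ≤ ‖x‖} := by
  rintro x ⟨hx, hn⟩
  have hpos : 0 < ‖x‖ := norm_pos_iff.mpr hx
  have h := Nat.lt_floor_add_one (‖x‖⁻¹)
  rw [hn] at h
  exact (inv_le_comm₀ (by positivity) hpos).mpr h.le

lemma disjoint_shell : Pairwise (Function.onFun Disjoint (shell d)) := by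
  intro m n hmn
  rw [Function.onFun, Set.disjoint_left]
  rintro x ⟨_, h1⟩ ⟨_, h2⟩
  exact hmn (h1.symm.trans h2)

lemma disjoint_inter_shell (B : Set (EuclideanSpace ℝ (Fin d))) :
    Pairwise (Function.onFun Disjoint fun n => B ∩ shell d n) :=
  fun _ _ h => (disjoint_shell h).mono inter_subset_right inter_subset_right

lemma iUnion_shell : (⋃ n, shell d n) = {x | x ≠ 0} := by
  ext x
  simp [shell]

namespace PuncturedSignedMeasure

open scoped Classical in
/-- The finite signed measure `ν` on `{x | r ≤ |x|}`, extended by zero to the whole space. -/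
def truncate (ν : PuncturedSignedMeasure d) (r : ℝ) (hr : 0 < r) :
    SignedMeasure (EuclideanSpace ℝ (Fin d)) where
  measureOf' B := if MeasurableSet B then ν.toFun (B ∩ {x | r ≤ ‖x‖}) else 0
  empty' := by simp [ν.empty']
  not_measurable' := fun _ hB => if_neg hB
  m_iUnion' := by
    intro f hf hd
    have h := ν.hasSum' r hr (fun i => f i ∩ {x | r ≤ ‖x‖})
      (fun i => ⟨(hf i).inter (measurableSet_ge r), inter_subset_right⟩)
      (hd.mono fun i j => Disjoint.mono inf_le_left inf_le_left)
    simpa [hf, MeasurableSet.iUnion hf, Set.iUnion_inter] using h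

open scoped Classical in
lemma truncate_def (ν : PuncturedSignedMeasure d) {r : ℝ} (hr : 0 < r)
    (B : Set (EuclideanSpace ℝ (Fin d))) :
    ν.truncate r hr B = if MeasurableSet B then ν.toFun (B ∩ {x | r ≤ ‖x‖}) else 0 := rfl

lemma truncate_apply (ν : PuncturedSignedMeasure d) {r : ℝ} (hr : 0 < r)
    {B : Set (EuclideanSpace ℝ (Fin d))} (hB : AwayFromZero r B) :
    ν.truncate r hr B = ν.toFun B := by
  rw [truncate_def, if_pos hB.1, inter_eq_left.mpr hB.2]

/-- The positive part `ν⁺`: on every annulus it is the positive part, in the Jordan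
decomposition, of the signed measure `ν` away from zero; it does not charge `0`. It is
characterised by `posPart_zero` and `posPart_apply`, see `eq_of_agree`. -/
def posPart (ν : PuncturedSignedMeasure d) : Measure (EuclideanSpace ℝ (Fin d)) :=
  Measure.sum fun n : ℕ =>
    ((ν.truncate ((n : ℝ) + 1)⁻¹ (by positivity)).toJordanDecomposition.posPart).restrict
      (shell d n)

/-- The negative part `ν⁻`, defined in the same way as the positive part. -/
def negPart (ν : PuncturedSignedMeasure d) : Measure (EuclideanSpace ℝ (Fin d)) :=
  Measure.sum fun n : ℕ =>
    ((ν.truncate ((n : ℝ) + 1)⁻¹ (by positivity)).toJordanDecomposition.negPart).restrict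
      (shell d n)

/-- The total variation `|ν|`. -/
def totalVariation (ν : PuncturedSignedMeasure d) : Measure (EuclideanSpace ℝ (Fin d)) :=
  ν.posPart + ν.negPart

lemma sum_shell_zero (m : ℕ → Measure (EuclideanSpace ℝ (Fin d))) :
    (Measure.sum fun n => (m n).restrict (shell d n)) {0} = 0 := by
  rw [Measure.sum_apply _ (measurableSet_singleton _)]
  refine ENNReal.tsum_eq_zero.mpr fun n => ?_
  rw [Measure.restrict_apply (measurableSet_singleton _)]
  have : ({0} : Set (EuclideanSpace ℝ (Fin d))) ∩ shell d n = ∅ := by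
    ext x
    simp only [shell, mem_inter_iff, mem_singleton_iff, mem_ofPred_eq, mem_empty_iff_false]
    tauto
  rw [this, measure_empty]

/-- The positive part does not charge the origin. -/
lemma posPart_zero (ν : PuncturedSignedMeasure d) : ν.posPart {0} = 0 := sum_shell_zero _

/-- The negative part does not charge the origin. -/
lemma negPart_zero (ν : PuncturedSignedMeasure d) : ν.negPart {0} = 0 := sum_shell_zero _

lemma jordan_restrict (ν : PuncturedSignedMeasure d) {r s : ℝ} (hr : 0 < r) (hrs : r ≤ s) :
    (ν.truncate s (hr.trans_le hrs)).toJordanDecomposition.posPart =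
        (ν.truncate r hr).toJordanDecomposition.posPart.restrict {x | s ≤ ‖x‖} ∧
      (ν.truncate s (hr.trans_le hrs)).toJordanDecomposition.negPart =
        (ν.truncate r hr).toJordanDecomposition.negPart.restrict {x | s ≤ ‖x‖} := by
  set t := (ν.truncate r hr).toJordanDecomposition with ht
  let j : JordanDecomposition (EuclideanSpace ℝ (Fin d)) :=
    { posPart := t.posPart.restrict {x | s ≤ ‖x‖}
      negPart := t.negPart.restrict {x | s ≤ ‖x‖}
      mutuallySingular := (t.mutuallySingular.restrict _).symm.restrict _ |>.symm }
  have key : (ν.truncate s (hr.trans_le hrs)).toJordanDecomposition = j := by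
    apply SignedMeasure.toJordanDecomposition_eq
    ext B hB
    have hC : MeasurableSet (B ∩ {x : EuclideanSpace ℝ (Fin d) | s ≤ ‖x‖}) :=
      hB.inter (measurableSet_ge s)
    have hA : AwayFromZero s (B ∩ {x : EuclideanSpace ℝ (Fin d) | s ≤ ‖x‖}) :=
      ⟨hC, inter_subset_right⟩
    have h1 : ν.truncate s (hr.trans_le hrs) B =
        ν.truncate r hr (B ∩ {x | s ≤ ‖x‖}) := by
      rw [ν.truncate_apply hr ⟨hC, fun x hx => hrs.trans hx.2⟩, truncate_def, if_pos hB]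
    rw [h1, SignedMeasure.apply_eq_posPart_real_sub_negPart_real _ hC,
      JordanDecomposition.toSignedMeasure, Measure.toSignedMeasure_sub_apply hB]
    simp only [j, measureReal_restrict_apply hB]
    rfl
  exact ⟨congrArg JordanDecomposition.posPart key, congrArg JordanDecomposition.negPart key⟩

lemma jordan_agree (ν : PuncturedSignedMeasure d) {r s : ℝ} (hr : 0 < r) (hs : 0 < s)
    {B : Set (EuclideanSpace ℝ (Fin d))} (hBr : AwayFromZero r B) (hBs : AwayFromZero s B) :
    (ν.truncate r hr).toJordanDecomposition.posPart B =
        (ν.truncate s hs).toJordanDecomposition.posPart B ∧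
      (ν.truncate r hr).toJordanDecomposition.negPart B =
        (ν.truncate s hs).toJordanDecomposition.negPart B := by
  rcases le_total r s with h | h
  · obtain ⟨h1, h2⟩ := ν.jordan_restrict hr h
    rw [h1, h2, Measure.restrict_apply hBs.1, Measure.restrict_apply hBs.1,
      inter_eq_left.mpr hBs.2]
    exact ⟨rfl, rfl⟩
  · obtain ⟨h1, h2⟩ := ν.jordan_restrict hs h
    rw [h1, h2, Measure.restrict_apply hBs.1, Measure.restrict_apply hBs.1,
      inter_eq_left.mpr hBr.2]
    exact ⟨rfl, rfl⟩

lemma sum_shell_apply (m : ℕ → Measure (EuclideanSpace ℝ (Fin d)))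
    (p : Measure (EuclideanSpace ℝ (Fin d))) {r : ℝ} (hr : 0 < r)
    {B : Set (EuclideanSpace ℝ (Fin d))} (hB : AwayFromZero r B)
    (h : ∀ n, m n (B ∩ shell d n) = p (B ∩ shell d n)) :
    (Measure.sum fun n => (m n).restrict (shell d n)) B = p B := by
  have hU : B = ⋃ n, B ∩ shell d n := by
    rw [← inter_iUnion, iUnion_shell, eq_comm, inter_eq_left]
    rintro x hx rfl
    have := hB.2 hx
    simp only [mem_ofPred_eq, norm_zero] at this
    linarith
  rw [Measure.sum_apply _ hB.1]
  conv_rhs => rw [hU]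
  rw [measure_iUnion
    (disjoint_inter_shell B)
    (fun n => hB.1.inter (measurableSet_shell n))]
  exact tsum_congr fun n => by rw [Measure.restrict_apply hB.1, h n]

/-- Away from zero, `ν⁺` is the positive part of the signed measure `ν`. -/
lemma posPart_apply (ν : PuncturedSignedMeasure d) {r : ℝ} (hr : 0 < r)
    {B : Set (EuclideanSpace ℝ (Fin d))} (hB : AwayFromZero r B) :
    ν.posPart B = (ν.truncate r hr).toJordanDecomposition.posPart B :=
  sum_shell_apply _ _ hr hB fun n =>
    (ν.jordan_agree _ hr
      ⟨hB.1.inter (measurableSet_shell n), inter_subset_right.trans (shell_subset n)⟩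
      ⟨hB.1.inter (measurableSet_shell n), inter_subset_left.trans hB.2⟩).1

/-- Away from zero, `ν⁻` is the negative part of the signed measure `ν`. -/
lemma negPart_apply (ν : PuncturedSignedMeasure d) {r : ℝ} (hr : 0 < r)
    {B : Set (EuclideanSpace ℝ (Fin d))} (hB : AwayFromZero r B) :
    ν.negPart B = (ν.truncate r hr).toJordanDecomposition.negPart B :=
  sum_shell_apply _ _ hr hB fun n =>
    (ν.jordan_agree _ hr
      ⟨hB.1.inter (measurableSet_shell n), inter_subset_right.trans (shell_subset n)⟩
      ⟨hB.1.inter (measurableSet_shell n), inter_subset_left.trans hB.2⟩).2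

/-- A measure that does not charge the origin is determined by its values on the sets bounded
away from zero. -/
lemma eq_of_agree (p q : Measure (EuclideanSpace ℝ (Fin d))) (hp : p {0} = 0) (hq : q {0} = 0)
    (h : ∀ r : ℝ, 0 < r → ∀ B, AwayFromZero r B → p B = q B) : p = q := by
  have aux : ∀ p : Measure (EuclideanSpace ℝ (Fin d)), p {0} = 0 → ∀ B, MeasurableSet B →
      p B = ∑' n, p (B ∩ shell d n) := by
    intro p hp B hB
    have hd : p B = p (B ∩ {x | x ≠ 0}) := by
      refine le_antisymm ?_ (measure_mono inter_subset_left)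
      calc p B ≤ p ((B ∩ {x | x ≠ 0}) ∪ {0}) := measure_mono fun x hx => by
            by_cases h0 : x = 0
            · exact Or.inr h0
            · exact Or.inl ⟨hx, h0⟩
        _ ≤ p (B ∩ {x | x ≠ 0}) + p {0} := measure_union_le _ _
        _ = p (B ∩ {x | x ≠ 0}) := by rw [hp, add_zero]
    rw [hd, ← iUnion_shell, inter_iUnion, measure_iUnion
      (disjoint_inter_shell B)
      (fun n => hB.inter (measurableSet_shell n))]
  refine Measure.ext fun B hB => ?_
  rw [aux p hp B hB, aux q hq B hB]
  exact tsum_congr fun n => h ((n : ℝ) + 1)⁻¹ (by positivity) _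
    ⟨hB.inter (measurableSet_shell n), inter_subset_right.trans (shell_subset n)⟩

/-- `f` is integrable with respect to `ν` if it is integrable with respect to `|ν|`. -/
def IntegrableFun {F : Type*} [NormedAddCommGroup F]
    (ν : PuncturedSignedMeasure d) (f : EuclideanSpace ℝ (Fin d) → F) : Prop :=
  Integrable f ν.totalVariation

/-- The integral of `f` with respect to `ν` (to be used for `ν`-integrable `f` only). -/
def integral {F : Type*} [NormedAddCommGroup F] [NormedSpace ℝ F]
    (ν : PuncturedSignedMeasure d) (f : EuclideanSpace ℝ (Fin d) → F) : F :=
  (∫ x, f x ∂ν.posPart) - ∫ x, f x ∂ν.negPart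

/-- `ν` is a quasi-Lévy type measure if `1 ∧ |x|²` is integrable with respect to `ν`. -/
def IsQuasiLevyType (ν : PuncturedSignedMeasure d) : Prop :=
  ν.IntegrableFun fun x => min 1 (‖x‖ ^ 2)

end PuncturedSignedMeasure

/-! ### Lévy-Khintchine type representation -/

/-- The linear map of `ℝ^d` given by a `d × d` matrix, `x ↦ M x`. -/
def matVec (M : Matrix (Fin d) (Fin d) ℝ) (x : EuclideanSpace ℝ (Fin d)) :
    EuclideanSpace ℝ (Fin d) :=
  WithLp.toLp 2 (M.mulVec (WithLp.ofLp x))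

/-- The vector `x 𝟙_{[0,1]}(|x|)`. -/
def stdRep (x : EuclideanSpace ℝ (Fin d)) : EuclideanSpace ℝ (Fin d) :=
  (Metric.closedBall (0 : EuclideanSpace ℝ (Fin d)) 1).indicator id x

/-- `(A, ν, γ)` is the (standard) characteristic triplet of the distribution `μ`: `A` is
symmetric, `ν` is a quasi-Lévy type measure, and for all `z`
`μ̂(z) = exp (i⟨γ,z⟩ - ⟨z,Az⟩/2 + ∫ (exp(i⟨z,x⟩) - 1 - i⟨z,x⟩ 𝟙_{[0,1]}(|x|)) ν(dx))`. -/
def IsCharTriplet (μ : Measure (EuclideanSpace ℝ (Fin d))) (A : Matrix (Fin d) (Fin d) ℝ)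
    (ν : PuncturedSignedMeasure d) (γ : EuclideanSpace ℝ (Fin d)) : Prop :=
  A.IsSymm ∧ ν.IsQuasiLevyType ∧
    ∀ z : EuclideanSpace ℝ (Fin d),
      charFun μ z = Complex.exp
        (Complex.I * ((inner ℝ γ z : ℝ) : ℂ) - (1 / 2 : ℂ) * ((inner ℝ z (matVec A z) : ℝ) : ℂ)
          + ν.integral fun x =>
              Complex.exp (Complex.I * ((inner ℝ z x : ℝ) : ℂ)) - 1
                - Complex.I * ((inner ℝ z (stdRep x) : ℝ) : ℂ))

/-- The drift `γ - ∫_{|x| ≤ 1} x ν(dx)` belonging to a characteristic triplet `(A, ν, γ)` for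
which `∫_{|x| ≤ 1} |x| |ν|(dx) < ∞`. -/
def drift (ν : PuncturedSignedMeasure d) (γ : EuclideanSpace ℝ (Fin d)) :
    EuclideanSpace ℝ (Fin d) :=
  γ - ν.integral stdRep

/-- The lattice `M ℤ^d + b`. -/
def lattice (M : Matrix (Fin d) (Fin d) ℝ) (b : EuclideanSpace ℝ (Fin d)) :
    Set (EuclideanSpace ℝ (Fin d)) :=
  {x | ∃ k : Fin d → ℤ, x = matVec M (WithLp.toLp 2 fun i => (k i : ℝ)) + b}

end QuasiID

end

/-! The atoms of μ are summable, so μ̂(z) = e^{i⟨b,z⟩} F((2π)⁻¹Mᵀz) for a function F on the torus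
with absolutely convergent Fourier series. The parallelepiped in the statement covers a full period,
so F is zero-free if μ̂ is zero-free there. On the covering space ℝ^d, F has a continuous logarithm,
which is a linear phase with integer winding vector c plus a periodic function g (`exists_winding`).
The Wiener–Lévy theorem `wnorm_ne_top_of_exp` makes the Fourier series of g absolutely convergent,
and the symmetry F(-x) = conj F(x) allows real coefficients a_k. Hence (`exists_charFun_eq_exp`)
μ̂(z) = exp(i⟨Mc+b,z⟩ + ∑ a_k (e^{i⟨z,Mk⟩} - 1)).

Separating positive from negative a_k exhibits μ̂ as a quotient for two compound Poisson laws, the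
first with drift. The same formula is a Lévy–Khintchine representation with no Gaussian part,
quasi-Lévy measure ∑_{k≠0} a_k δ_{Mk} and drift Mc+b.

Conversely, a zero of an infinitely divisible characteristic function would be shared by all its
convolution roots, and a doubling inequality excludes this
(`IsInfinitelyDivisible.charFun_ne_zero`). For uniqueness (`IsCharTriplet.unique`), two exponents of
μ are continuous logarithms of the same function, hence equal. Their second differences in direction
h are -⟨h,Ah⟩ minus the Fourier transform of the finite signed measure (2 - 2cos⟨h,x⟩)ν(dx), which
has no atom at 0. This determines A and ν, and then γ. -/

noncomputable section

/-! ### The Wiener algebra of the torus -/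

namespace WienerAlgebra

open UnitAddTorus Filter
open scoped ComplexConjugate

variable {ι : Type*} [Fintype ι]

local instance : MeasureSpace UnitAddCircle := ⟨AddCircle.haarAddCircle⟩

local instance : IsProbabilityMeasure (volume : Measure UnitAddCircle) :=
  inferInstanceAs (IsProbabilityMeasure AddCircle.haarAddCircle)

lemma mFourierCoeff_eq_repr (f : C(UnitAddTorus ι, ℂ)) (n : ι → ℤ) :
    mFourierCoeff f n = mFourierBasis.repr (ContinuousMap.toLp 2 volume ℂ f) n := by
  rw [mFourierBasis_repr, mFourierCoeff_toLp]

/-- The Fourier coefficients of a continuous function on the torus, as linear functionals. -/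
def coeff (n : ι → ℤ) : C(UnitAddTorus ι, ℂ) →ₗ[ℂ] ℂ where
  toFun f := mFourierCoeff f n
  map_add' f g := by
    rw [mFourierCoeff_eq_repr, mFourierCoeff_eq_repr, mFourierCoeff_eq_repr, map_add, map_add]
    rfl
  map_smul' c f := by
    rw [mFourierCoeff_eq_repr, mFourierCoeff_eq_repr, map_smul, map_smul]
    rfl

lemma norm_coeff_le (n : ι → ℤ) (f : C(UnitAddTorus ι, ℂ)) : ‖coeff n f‖ ≤ ‖f‖ := by
  change ‖∫ t, mFourier (-n) t • f t‖ ≤ ‖f‖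
  refine (norm_integral_le_of_norm_le_const (C := ‖f‖) (ae_of_all _ fun t => ?_)).trans ?_
  · rw [norm_smul]
    calc _ ≤ 1 * ‖f‖ := by
          gcongr
          · exact ((mFourier (-n)).norm_coe_le_norm t).trans_eq mFourier_norm
          · exact f.norm_coe_le_norm t
      _ = _ := one_mul _
  · simp

lemma continuous_coeff (n : ι → ℤ) : Continuous (coeff (ι := ι) n) :=
  (LinearMap.mkContinuous (coeff n) 1 fun f => by simpa using norm_coeff_le n f).continuous

lemma coeff_mFourier_mul (m n : ι → ℤ) (f : C(UnitAddTorus ι, ℂ)) :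
    coeff n (mFourier m * f) = coeff (n - m) f := by
  change ∫ t, mFourier (-n) t • (mFourier m t * f t) = ∫ t, mFourier (-(n - m)) t • f t
  congr 1
  ext t
  rw [smul_eq_mul, smul_eq_mul, ← mul_assoc, ← mFourier_add]
  congr 3
  abel

lemma coeff_mFourier [DecidableEq ι] (m n : ι → ℤ) :
    coeff n (mFourier m) = if n = m then 1 else 0 := by
  change mFourierCoeff _ _ = _
  rw [mFourierCoeff_eq_repr]
  change mFourierBasis.repr (mFourierLp 2 m) n = _
  rw [← coe_mFourierBasis, HilbertBasis.repr_self]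
  simp [lp.single_apply, Pi.single_apply]

/-- The norm of the Wiener algebra: the sum of the absolute values of the Fourier coefficients
(infinite if the Fourier series does not converge absolutely). -/
def wnorm (f : C(UnitAddTorus ι, ℂ)) : ℝ≥0∞ := ∑' n, ‖coeff n f‖ₑ

lemma summable_coeff {f : C(UnitAddTorus ι, ℂ)} (hf : wnorm f ≠ ∞) :
    Summable fun n => ‖coeff n f‖ :=
  tsum_enorm_ne_top_iff_summable_norm.1 hf

lemma hasSum_coeff {f : C(UnitAddTorus ι, ℂ)} (hf : wnorm f ≠ ∞) :
    HasSum (fun n => coeff n f • mFourier n) f :=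
  hasSum_mFourier_series_of_summable (Summable.of_enorm hf)

lemma wnorm_add_le (f g : C(UnitAddTorus ι, ℂ)) : wnorm (f + g) ≤ wnorm f + wnorm g := by
  simp only [wnorm, map_add, ← ENNReal.tsum_add]
  exact ENNReal.tsum_le_tsum fun n => enorm_add_le _ _

lemma wnorm_smul (c : ℂ) (f : C(UnitAddTorus ι, ℂ)) : wnorm (c • f) = ‖c‖ₑ * wnorm f := by
  simp only [wnorm, map_smul, smul_eq_mul, enorm_mul, ENNReal.tsum_mul_left]

lemma wnorm_neg (f : C(UnitAddTorus ι, ℂ)) : wnorm (-f) = wnorm f := by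
  simp [wnorm]

/-- Each Fourier coefficient is continuous for the uniform norm, so it passes through the sum; the
two summations are then exchanged. -/
lemma wnorm_le_of_hasSum {κ : Type*} {u : κ → C(UnitAddTorus ι, ℂ)} {f : C(UnitAddTorus ι, ℂ)}
    (h : HasSum u f) : wnorm f ≤ ∑' k, wnorm (u k) := by
  simp only [wnorm]
  rw [ENNReal.tsum_comm]
  refine ENNReal.tsum_le_tsum fun n => ?_
  rw [← (h.map (coeff n) (continuous_coeff n)).tsum_eq]
  exact enorm_tsum_le_tsum_enorm

lemma wnorm_mFourier_mul (m : ι → ℤ) (f : C(UnitAddTorus ι, ℂ)) :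
    wnorm (mFourier m * f) = wnorm f := by
  simp only [wnorm, coeff_mFourier_mul]
  exact (Equiv.subRight m).tsum_eq fun n => ‖coeff n f‖ₑ

lemma wnorm_mFourier (m : ι → ℤ) : wnorm (mFourier m : C(UnitAddTorus ι, ℂ)) = 1 := by
  classical
  simp only [wnorm, coeff_mFourier]
  rw [tsum_eq_single m (by simp +contextual)]
  simp

lemma wnorm_one : wnorm (1 : C(UnitAddTorus ι, ℂ)) = 1 := by
  rw [← mFourier_zero, wnorm_mFourier]

/-- Multiplication by a character only shifts the coefficients of g, so expanding f alone in its
uniformly convergent Fourier series suffices. -/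
lemma wnorm_mul_le {f : C(UnitAddTorus ι, ℂ)} (hf : wnorm f ≠ ∞) (g : C(UnitAddTorus ι, ℂ)) :
    wnorm (f * g) ≤ wnorm f * wnorm g := by
  refine (wnorm_le_of_hasSum ((hasSum_coeff hf).mul_right g)).trans_eq ?_
  simp only [smul_mul_assoc, wnorm_smul, wnorm_mFourier_mul, ENNReal.tsum_mul_right]
  rfl

lemma wnorm_pow_le {f : C(UnitAddTorus ι, ℂ)} (hf : wnorm f ≠ ∞) (k : ℕ) :
    wnorm (f ^ k) ≤ wnorm f ^ k := by
  induction k with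
  | zero => simp [wnorm_one]
  | succ k ih =>
    rw [pow_succ', pow_succ']
    exact (wnorm_mul_le hf _).trans (by gcongr)

lemma wnorm_exp_ne_top {f : C(UnitAddTorus ι, ℂ)} (hf : wnorm f ≠ ∞) :
    wnorm (NormedSpace.exp f) ≠ ∞ := by
  refine ne_top_of_le_ne_top ?_ (wnorm_le_of_hasSum (NormedSpace.exp_series_hasSum_exp' (𝕂 := ℂ) f))
  have hs := Real.summable_pow_div_factorial (wnorm f).toReal
  refine ne_top_of_le_ne_top hs.tsum_ofReal_ne_top (ENNReal.tsum_le_tsum fun n => ?_)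
  rw [wnorm_smul]
  refine (mul_le_mul_right (wnorm_pow_le hf n) _).trans_eq ?_
  rw [ENNReal.ofReal_div_of_pos (by positivity), ENNReal.ofReal_pow ENNReal.toReal_nonneg,
    ENNReal.ofReal_toReal hf, enorm_inv (Nat.cast_ne_zero.2 n.factorial_ne_zero), mul_comm,
    ENNReal.div_eq_inv_mul, mul_comm]
  congr 2
  rw [← ofReal_norm]
  simp

lemma norm_le_wnorm {f : C(UnitAddTorus ι, ℂ)} : ‖f‖ₑ ≤ wnorm f := by
  by_cases hf : wnorm f = ∞
  · simp [hf]
  · have h := enorm_tsum_le_tsum_enorm (f := fun n => coeff n f • mFourier n)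
    rw [(hasSum_coeff hf).tsum_eq] at h
    refine h.trans_eq ?_
    refine tsum_congr fun n => ?_
    rw [enorm_smul, ← ofReal_norm (mFourier n), mFourier_norm]
    simp

/-! ### Trigonometric polynomials and powers of small functions -/

/-- The trigonometric polynomials with all frequencies in the box `[-L, L]^ι`. -/
def trigPoly (ι : Type*) [Fintype ι] (L : ℕ) : Submodule ℂ C(UnitAddTorus ι, ℂ) :=
  Submodule.span ℂ (mFourier '' {n | ∀ i, |n i| ≤ (L : ℤ)})

lemma mul_mem_trigPoly {K L : ℕ} {f g : C(UnitAddTorus ι, ℂ)} (hf : f ∈ trigPoly ι K)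
    (hg : g ∈ trigPoly ι L) : f * g ∈ trigPoly ι (K + L) := by
  have h := Submodule.mul_mem_mul hf hg
  rw [trigPoly, trigPoly, Submodule.span_mul_span] at h
  refine Submodule.span_mono ?_ h
  rintro _ ⟨_, ⟨m, hm, rfl⟩, _, ⟨n, hn, rfl⟩, rfl⟩
  refine ⟨m + n, fun i => (abs_add_le _ _).trans ?_, ContinuousMap.ext fun x => mFourier_add⟩
  push_cast
  exact add_le_add (hm i) (hn i)

lemma pow_mem_trigPoly {L : ℕ} {f : C(UnitAddTorus ι, ℂ)} (hf : f ∈ trigPoly ι L) (k : ℕ) :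
    f ^ k ∈ trigPoly ι (k * L) := by
  induction k with
  | zero =>
    refine Submodule.subset_span ⟨0, by simp, ?_⟩
    rw [mFourier_zero, pow_zero]
  | succ k ih =>
    rw [pow_succ, Nat.succ_mul]
    exact mul_mem_trigPoly ih hf

lemma coeff_eq_zero_of_mem_trigPoly {L : ℕ} {f : C(UnitAddTorus ι, ℂ)} (hf : f ∈ trigPoly ι L)
    {n : ι → ℤ} (hn : ¬ ∀ i, |n i| ≤ (L : ℤ)) : coeff n f = 0 := by
  classical
  suffices trigPoly ι L ≤ LinearMap.ker (coeff n) from this hf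
  rw [trigPoly, Submodule.span_le]
  rintro _ ⟨m, hm, rfl⟩
  rw [SetLike.mem_coe, LinearMap.mem_ker, coeff_mFourier, if_neg]
  rintro rfl
  exact hn hm

/-- At most (2L+1)^|ι| coefficients are nonzero, each bounded by the sup norm. The loss is only
polynomial in the degree. -/
lemma wnorm_le_of_mem_trigPoly {L : ℕ} {f : C(UnitAddTorus ι, ℂ)} (hf : f ∈ trigPoly ι L) :
    wnorm f ≤ ENNReal.ofReal ((2 * L + 1) ^ Fintype.card ι * ‖f‖) := by
  classical
  have hbox : ∀ n : ι → ℤ, n ∉ Fintype.piFinset (fun _ : ι => Finset.Icc (-(L : ℤ)) L) →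
      ‖coeff n f‖ₑ = 0 := by
    intro n hn
    rw [coeff_eq_zero_of_mem_trigPoly hf, enorm_zero]
    simpa [Fintype.mem_piFinset, abs_le] using hn
  rw [wnorm, tsum_eq_sum hbox]
  have hle : ∀ n : ι → ℤ, ‖coeff n f‖ₑ ≤ ENNReal.ofReal ‖f‖ := fun n => by
    rw [← ofReal_norm]
    exact ENNReal.ofReal_le_ofReal (norm_coeff_le n f)
  refine (Finset.sum_le_sum fun n _ => hle n).trans_eq ?_
  rw [Finset.sum_const, Fintype.card_piFinset, Finset.prod_const, Finset.card_univ, Int.card_Icc, nsmul_eq_mul,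
    ENNReal.ofReal_mul (by positivity), ENNReal.ofReal_pow (by positivity)]
  congr 1
  rw [show ((L : ℤ) + 1 - -(L : ℤ)).toNat = 2 * L + 1 by omega]
  rw [Nat.cast_pow, ← ENNReal.ofReal_natCast]
  push_cast
  rfl

lemma exists_trigPoly_of_finset (S : Finset (ι → ℤ)) (c : (ι → ℤ) → ℂ) :
    ∃ L, ∑ n ∈ S, c n • mFourier n ∈ trigPoly ι L := by
  refine ⟨S.sup fun n => Finset.univ.sup fun i => (n i).natAbs, ?_⟩
  refine Submodule.sum_mem _ fun n hn => Submodule.smul_mem _ _ (Submodule.subset_span ⟨n, ?_, rfl⟩)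
  intro i
  rw [Int.abs_eq_natAbs]
  exact_mod_cast (Finset.le_sup (f := fun i => (n i).natAbs) (Finset.mem_univ i)).trans
    (Finset.le_sup (f := fun n : ι → ℤ => Finset.univ.sup fun i => (n i).natAbs) hn)

lemma exists_trigPoly_wnorm_sub_le {f : C(UnitAddTorus ι, ℂ)} (hf : wnorm f ≠ ∞) {ε : ℝ≥0∞}
    (hε : 0 < ε) : ∃ L, ∃ T ∈ trigPoly ι L, wnorm (f - T) < ε := by
  classical
  have h0 := ENNReal.tendsto_tsum_compl_atTop_zero hf
  obtain ⟨S, hS⟩ := (h0.eventually (gt_mem_nhds hε)).exists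
  obtain ⟨L, hL⟩ := exists_trigPoly_of_finset S fun n => coeff n f
  refine ⟨L, _, hL, lt_of_le_of_lt ?_ hS⟩
  set u : (ι → ℤ) → C(UnitAddTorus ι, ℂ) := fun n => coeff n f • mFourier n with hu
  have h2 : HasSum u (f - ∑ n ∈ S, u n + ∑ n ∈ S, u n) := by
    rw [sub_add_cancel]
    exact hasSum_coeff hf
  refine (wnorm_le_of_hasSum ((Finset.hasSum_compl_iff (f := u) S).2 h2)).trans_eq
    (tsum_congr fun n => ?_)
  rw [hu, wnorm_smul, wnorm_mFourier, mul_one]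

lemma wnorm_sum_le {κ : Type*} (s : Finset κ) (u : κ → C(UnitAddTorus ι, ℂ)) :
    wnorm (∑ k ∈ s, u k) ≤ ∑ k ∈ s, wnorm (u k) :=
  Finset.le_sum_of_subadditive _ (by simp [wnorm]) wnorm_add_le _ _

/-- A spectral radius estimate: in the binomial expansion of (T + (h - T))^n, powers of T are
measured in sup norm at polynomial cost, and powers of h - T in the Wiener norm. The exponential
rate is thus governed by the sup norm of T. -/
lemma wnorm_pow_le_of_trigPoly {h T : C(UnitAddTorus ι, ℂ)} {L : ℕ} (hT : T ∈ trigPoly ι L)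
    {ε : ℝ} (hε : 0 ≤ ε) (hu : wnorm (h - T) ≤ ENNReal.ofReal ε) (n : ℕ) :
    wnorm (h ^ n) ≤
      ENNReal.ofReal ((2 * L + 1) ^ Fintype.card ι * ((n + 1 : ℕ) ^ Fintype.card ι *
        (‖T‖ + ε) ^ n)) := by
  have hu' : wnorm (h - T) ≠ ∞ := ne_top_of_le_ne_top ENNReal.ofReal_ne_top hu
  have hterm : ∀ m ∈ Finset.range (n + 1),
      wnorm (T ^ m * (h - T) ^ (n - m) * (n.choose m : C(UnitAddTorus ι, ℂ))) ≤
        ENNReal.ofReal ((2 * L + 1) ^ Fintype.card ι * (n + 1 : ℕ) ^ Fintype.card ι *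
          (‖T‖ ^ m * ε ^ (n - m) * n.choose m)) := by
    intro m hm
    have hm' : m ≤ n := Nat.lt_succ_iff.1 (Finset.mem_range.1 hm)
    have e1 : T ^ m * (h - T) ^ (n - m) * (n.choose m : C(UnitAddTorus ι, ℂ)) =
        (n.choose m : ℂ) • (T ^ m * (h - T) ^ (n - m)) := by
      ext x
      simp [mul_comm]
    have h1 : wnorm (T ^ m) ≤ ENNReal.ofReal
        ((2 * L + 1) ^ Fintype.card ι * (n + 1 : ℕ) ^ Fintype.card ι * ‖T‖ ^ m) := by
      refine (wnorm_le_of_mem_trigPoly (pow_mem_trigPoly hT m)).trans (ENNReal.ofReal_le_ofReal ?_)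
      rw [← mul_pow]
      gcongr
      · push_cast
        have : (m : ℝ) ≤ n := by exact_mod_cast hm'
        -- T^m has degree mL, and 2mL + 1 ≤ (2L+1)(n+1) for m ≤ n.
        nlinarith [mul_nonneg (sub_nonneg.2 this) (Nat.cast_nonneg (α := ℝ) L),
          (Nat.cast_nonneg (α := ℝ) L), (Nat.cast_nonneg (α := ℝ) n)]
      · exact norm_pow_le _ _
    have h2 : wnorm ((h - T) ^ (n - m)) ≤ ENNReal.ofReal (ε ^ (n - m)) := by
      refine (wnorm_pow_le hu' _).trans ?_
      rw [ENNReal.ofReal_pow hε]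
      gcongr
    have h3 : ‖(n.choose m : ℂ)‖ₑ = ENNReal.ofReal (n.choose m) := by
      rw [← ofReal_norm]
      simp
    rw [e1, wnorm_smul, h3]
    calc _ ≤ ENNReal.ofReal (n.choose m) * (ENNReal.ofReal
        ((2 * L + 1) ^ Fintype.card ι * (n + 1 : ℕ) ^ Fintype.card ι * ‖T‖ ^ m) *
          ENNReal.ofReal (ε ^ (n - m))) := by
          gcongr
          exact (wnorm_mul_le (ne_top_of_le_ne_top ENNReal.ofReal_ne_top h1) _).trans
            (mul_le_mul' h1 h2)
      _ = _ := by
          rw [← ENNReal.ofReal_mul (by positivity), ← ENNReal.ofReal_mul (by positivity)]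
          congr 1
          ring
  have e : h ^ n = (T + (h - T)) ^ n := by rw [add_sub_cancel]
  rw [e, add_pow]
  refine (wnorm_sum_le _ _).trans ((Finset.sum_le_sum hterm).trans_eq ?_)
  rw [← ENNReal.ofReal_sum_of_nonneg fun m _ => by positivity, ← Finset.mul_sum, ← add_pow,
    mul_assoc]

/-- The powers of an element of the Wiener algebra of small supremum norm are summable in the Wiener
norm. -/
lemma wnorm_tsum_pow_ne_top {h : C(UnitAddTorus ι, ℂ)} (hf : wnorm h ≠ ∞) (hh : ‖h‖ ≤ 1 / 4) :
    ∑' n : ℕ, wnorm (h ^ n) ≠ ∞ := by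
  -- With 1/8, ‖T‖ ≤ 1/4 + 1/8, so the ratio ‖T‖ + 1/8 is at most 1/2.
  obtain ⟨L, T, hT, hu⟩ := exists_trigPoly_wnorm_sub_le hf
    (ε := ENNReal.ofReal (1 / 8)) (by simp)
  have hTn : ‖T‖ ≤ 3 / 8 := by
    have h1 : ‖h - T‖ ≤ 1 / 8 := by
      have := (norm_le_wnorm (f := h - T)).trans hu.le
      rwa [← ofReal_norm, ENNReal.ofReal_le_ofReal_iff (by norm_num)] at this
    calc ‖T‖ = ‖h - (h - T)‖ := by rw [sub_sub_cancel]
      _ ≤ ‖h‖ + ‖h - T‖ := norm_sub_le _ _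
      _ ≤ 3 / 8 := by linarith
  have hs : Summable fun n : ℕ => (2 * (L : ℝ) + 1) ^ Fintype.card ι *
      (((n + 1 : ℕ) : ℝ) ^ Fintype.card ι * (‖T‖ + 1 / 8) ^ n) := by
    refine Summable.mul_left _ ?_
    have h1 := (summable_nat_add_iff 1).2 (summable_pow_mul_geometric_of_norm_lt_one (R := ℝ)
      (Fintype.card ι) (r := 1 / 2) (by norm_num))
    refine Summable.of_nonneg_of_le (fun n => by positivity) (fun n => ?_) (h1.mul_left 2)
    rw [pow_succ (1 / 2 : ℝ) n]
    calc _ ≤ ((n + 1 : ℕ) : ℝ) ^ Fintype.card ι * (1 / 2) ^ n := by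
          gcongr
          linarith
      _ = _ := by ring
  exact ne_top_of_le_ne_top hs.tsum_ofReal_ne_top
    (ENNReal.tsum_le_tsum fun n => wnorm_pow_le_of_trigPoly hT (by norm_num) hu.le n)

/-! ### Logarithms in the Wiener algebra -/

lemma exp_apply (f : C(UnitAddTorus ι, ℂ)) (x : UnitAddTorus ι) :
    NormedSpace.exp f x = Complex.exp (f x) := by
  rw [Complex.exp_eq_exp_ℂ]
  have h1 := (ContinuousMap.evalCLM ℂ x).hasSum
    (NormedSpace.exp_series_hasSum_exp' (𝕂 := ℂ) f)
  exact h1.unique (by simpa using! NormedSpace.exp_series_hasSum_exp' (𝕂 := ℂ) (f x))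

/-- A function whose exponential is uniformly close to `1` and in the Wiener algebra is itself in
the Wiener algebra, if it is small. -/
lemma wnorm_ne_top_of_exp_of_norm_le {g : C(UnitAddTorus ι, ℂ)}
    (hg : wnorm (NormedSpace.exp g) ≠ ∞) (hn : ‖g‖ ≤ 1 / 8) : wnorm g ≠ ∞ := by
  set h : C(UnitAddTorus ι, ℂ) := NormedSpace.exp g - 1 with hh
  have hgx : ∀ x, ‖g x‖ ≤ 1 / 8 := fun x => (g.norm_coe_le_norm x).trans hn
  have hx : ∀ x, h x = Complex.exp (g x) - 1 := fun x => by simp [hh, exp_apply]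
  have hnorm : ‖h‖ ≤ 1 / 4 := by
    refine (ContinuousMap.norm_le _ (by norm_num)).2 fun x => ?_
    rw [hx]
    refine (Complex.norm_exp_sub_one_le ((hgx x).trans (by norm_num))).trans ?_
    linarith [hgx x]
  have hw : wnorm h ≠ ∞ := by
    rw [hh, sub_eq_add_neg]
    refine ne_top_of_le_ne_top ?_ (wnorm_add_le _ _)
    rw [wnorm_neg, wnorm_one]
    exact ENNReal.add_ne_top.2 ⟨hg, by simp⟩
  -- The imaginary part of g stays within 1/8 < π, so the principal branch recovers g.
  have hlog : ∀ x, Complex.log (1 + h x) = g x := by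
    intro x
    rw [hx, add_sub_cancel, Complex.log_exp]
    · have := (abs_le.1 (Complex.abs_im_le_norm (g x))).1
      linarith [hgx x, Real.pi_gt_three]
    · have := (abs_le.1 (Complex.abs_im_le_norm (g x))).2
      linarith [hgx x, Real.pi_gt_three]
  -- The term n = 0 vanishes because division by zero gives 0; the rest is the Taylor series of
  -- log(1 + h).
  have hsum : Summable fun n : ℕ => ((-1) ^ (n + 1) / n : ℂ) • h ^ n := by
    refine Summable.of_norm_bounded (g := fun n : ℕ => (1 / 4 : ℝ) ^ n)
      (summable_geometric_of_lt_one (by norm_num) (by norm_num)) fun n => ?_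
    rw [norm_smul, norm_div, norm_pow, norm_neg, norm_one, one_pow, Complex.norm_natCast]
    calc _ ≤ 1 * (1 / 4 : ℝ) ^ n := by
          gcongr
          · exact (one_div _).trans_le (Nat.cast_inv_le_one n)
          · exact (norm_pow_le h n).trans (by gcongr)
      _ = _ := one_mul _
  have hgsum : HasSum (fun n : ℕ => ((-1) ^ (n + 1) / n : ℂ) • h ^ n) g := by
    convert! hsum.hasSum
    ext x
    have h1 := (ContinuousMap.evalCLM ℂ x).hasSum hsum.hasSum
    refine HasSum.unique ?_ h1
    rw [← hlog]
    have h2 := Complex.hasSum_taylorSeries_log (z := h x)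
      (((h.norm_coe_le_norm x).trans hnorm).trans_lt (by norm_num))
    convert! h2 using 2 with n
    simp
    ring
  refine ne_top_of_le_ne_top (wnorm_tsum_pow_ne_top hw hnorm)
    ((wnorm_le_of_hasSum hgsum).trans (ENNReal.tsum_le_tsum fun n => ?_))
  rw [wnorm_smul]
  refine mul_le_of_le_one_left' ?_
  rw [← ofReal_norm, ENNReal.ofReal_le_one, norm_div, norm_pow, norm_neg, norm_one, one_pow,
    Complex.norm_natCast]
  exact (one_div _).trans_le (Nat.cast_inv_le_one n)

/-- The **Wiener–Lévy theorem** for the logarithm: if the exponential of a continuous function on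
the torus has an absolutely convergent Fourier series, then so has the function. -/
theorem wnorm_ne_top_of_exp {g : C(UnitAddTorus ι, ℂ)} (hg : wnorm (NormedSpace.exp g) ≠ ∞) :
    wnorm g ≠ ∞ := by
  have hd : g ∈ closure (Submodule.span ℂ (range (mFourier (d := ι))) : Set C(UnitAddTorus ι, ℂ)) := by
    rw [← Submodule.topologicalClosure_coe, span_mFourier_closure_eq_top]
    trivial
  -- Density of trigonometric polynomials reduces the claim to the small function g - P; 1/8 is the
  -- threshold of `wnorm_ne_top_of_exp_of_norm_le`.
  obtain ⟨P, hP, hPg⟩ := Metric.mem_closure_iff.1 hd (1 / 8) (by norm_num)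
  have hPw : wnorm P ≠ ∞ := by
    refine Submodule.span_induction (p := fun P _ => wnorm P ≠ ∞) ?_ ?_ ?_ ?_ hP
    · rintro _ ⟨n, rfl⟩
      simp [wnorm_mFourier]
    · simp [wnorm]
    · intro x y _ _ hx hy
      exact ne_top_of_le_ne_top (ENNReal.add_ne_top.2 ⟨hx, hy⟩) (wnorm_add_le _ _)
    · intro a x _ hx
      rw [wnorm_smul]
      exact ENNReal.mul_ne_top (by simp) hx
  -- exp(g - P) = exp(g) exp(-P) is a product of two elements of the algebra.
  have hexp : wnorm (NormedSpace.exp (g - P)) ≠ ∞ := by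
    rw [sub_eq_add_neg, NormedSpace.exp_add_of_commute (Commute.all _ _)]
    exact ne_top_of_le_ne_top
      (ENNReal.mul_ne_top hg (wnorm_exp_ne_top (by rwa [wnorm_neg]))) (wnorm_mul_le hg _)
  have h1 := wnorm_ne_top_of_exp_of_norm_le hexp (by rw [← dist_eq_norm]; exact hPg.le)
  have h2 := wnorm_add_le (g - P) P
  rw [sub_add_cancel] at h2
  exact ne_top_of_le_ne_top (ENNReal.add_ne_top.2 ⟨h1, hPw⟩) h2

end WienerAlgebra

/-! ### Continuous logarithms and winding vectors on the torus -/

namespace WienerAlgebra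

open UnitAddTorus Filter
open scoped ComplexConjugate

variable {ι : Type*}

/-- The covering map from `ℝ^ι` to the torus. -/
def toTorus (ι : Type*) : C(ι → ℝ, UnitAddTorus ι) where
  toFun x i := (x i : UnitAddCircle)
  continuous_toFun := by
    refine continuous_pi fun i => ?_
    exact (AddCircle.continuous_mk' 1).comp (continuous_apply i)

lemma isOpenQuotientMap_toTorus (ι : Type*) : IsOpenQuotientMap (toTorus ι) :=
  IsOpenQuotientMap.piMap (f := fun (_ : ι) (x : ℝ) => (x : UnitAddCircle))
    fun _ => QuotientAddGroup.isOpenQuotientMap_mk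

lemma toTorus_neg (x : ι → ℝ) : toTorus ι (-x) = -toTorus ι x := rfl

lemma toTorus_eq_iff {x y : ι → ℝ} :
    toTorus ι x = toTorus ι y ↔ ∃ n : ι → ℤ, y = x + fun i => (n i : ℝ) := by
  constructor
  · intro h
    have h1 : ∀ i, ∃ n : ℤ, y i = x i + n := fun i => by
      have h2 : (x i : UnitAddCircle) = (y i : UnitAddCircle) := congrFun h i
      obtain ⟨n, hn⟩ := AddSubgroup.mem_zmultiples_iff.1 (QuotientAddGroup.eq.1 h2)
      refine ⟨n, ?_⟩
      rw [zsmul_one] at hn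
      linarith
    choose n hn using h1
    exact ⟨n, funext hn⟩
  · rintro ⟨n, rfl⟩
    funext i
    refine QuotientAddGroup.eq.2 (AddSubgroup.mem_zmultiples_iff.2 ⟨n i, ?_⟩)
    simp

/-- The exponential covers the punctured plane, and lifts on a connected space that agree at one
point agree everywhere. This uniqueness gives periodicity and symmetry of the logarithm, and later
the equality of characteristic exponents. -/
lemma eq_of_exp_eq {X : Type*} [TopologicalSpace X] [PreconnectedSpace X] {f g : X → ℂ}
    (hf : Continuous f) (hg : Continuous g) (h : ∀ x, Complex.exp (f x) = Complex.exp (g x))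
    {x₀ : X} (h₀ : f x₀ = g x₀) : f = g :=
  Complex.isCoveringMap_exp.eq_of_comp_eq hf hg (funext fun x => Subtype.ext (h x)) x₀ h₀

/-- Continuous logarithms on `ℝ^ι` of nonvanishing functions on the torus. -/
lemma exists_log_lift {F : C(UnitAddTorus ι, ℂ)} (h0 : ∀ x, F x ≠ 0) (h1 : F 0 = 1) :
    ∃ θ : C(ι → ℝ, ℂ), θ 0 = 0 ∧ ∀ x, Complex.exp (θ x) = F (toTorus ι x) := by
  obtain ⟨θ, ⟨hθ, hθ'⟩, -⟩ := Complex.isCoveringMapOn_exp.existsUnique_continuousMap_lifts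
    (F.comp (toTorus ι)) (a₀ := 0) (e₀ := 0)
    (by rw [Complex.exp_zero]; exact h1.symm) (fun a => h0 _)
  exact ⟨θ, hθ, fun x => congrFun hθ' x⟩

variable [Fintype ι]

/-- The phase `2π⟨n, x⟩`. -/
def phase (n : ι → ℤ) (x : ι → ℝ) : ℝ := 2 * Real.pi * ∑ i, n i * x i

lemma phase_add (n : ι → ℤ) (x y : ι → ℝ) : phase n (x + y) = phase n x + phase n y := by
  simp [phase, mul_add, Finset.sum_add_distrib]

lemma phase_neg (n : ι → ℤ) (x : ι → ℝ) : phase n (-x) = -phase n x := by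
  simp [phase]

@[simp] lemma phase_zero (n : ι → ℤ) : phase n 0 = 0 := by simp [phase]

lemma continuous_phase (n : ι → ℤ) : Continuous (phase n) := by
  unfold phase
  fun_prop

lemma mFourier_toTorus (n : ι → ℤ) (x : ι → ℝ) :
    mFourier n (toTorus ι x) = Complex.exp (Complex.I * (phase n x : ℂ)) := by
  change ∏ i, fourier (n i) (x i : UnitAddCircle) = _
  simp only [fourier_coe_apply]
  rw [← Complex.exp_sum, phase]
  congr 1
  push_cast
  rw [Finset.mul_sum, Finset.mul_sum]
  refine Finset.sum_congr rfl fun i _ => ?_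
  rw [div_one]
  ring

/-- A nonvanishing function on the torus is a character times the exponential of a continuous
function. -/
lemma exists_winding {F : C(UnitAddTorus ι, ℂ)} {θ : C(ι → ℝ, ℂ)} (hθ0 : θ 0 = 0)
    (hθ : ∀ x, Complex.exp (θ x) = F (toTorus ι x)) :
    ∃ (c : ι → ℤ) (g : C(UnitAddTorus ι, ℂ)), ∀ x,
      θ x = Complex.I * (phase c x : ℂ) + g (toTorus ι x) := by
  classical
  have hF1 : F (toTorus ι 0) = 1 := by rw [← hθ, hθ0, Complex.exp_zero]
  have hper : ∀ (x : ι → ℝ) (n : ι → ℤ),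
      toTorus ι (x + fun i => (n i : ℝ)) = toTorus ι x :=
    fun x n => (toTorus_eq_iff.2 ⟨n, rfl⟩).symm
  have hcast : ∀ i : ι, (Pi.single i 1 : ι → ℝ) = fun j => (((Pi.single i 1 : ι → ℤ) j : ℤ) : ℝ) := by
    intro i
    ext j
    by_cases h : j = i
    · subst h; simp
    · simp [h]
  -- The increment of θ along the i-th basic loop, divided by 2πi, is the winding number.
  have hc : ∀ i : ι, ∃ n : ℤ, θ (Pi.single i 1) = n * (2 * Real.pi * Complex.I) := by
    intro i
    rw [← Complex.exp_eq_one_iff, hθ, ← hF1]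
    congr 1
    have := hper 0 (Pi.single i 1)
    rwa [← hcast, zero_add] at this
  choose c hc using hc
  have hcont : Continuous fun x => θ x - Complex.I * (phase c x : ℂ) := by
    have := continuous_phase c
    fun_prop
  let G : C(ι → ℝ, ℂ) := ⟨fun x => θ x - Complex.I * (phase c x : ℂ), hcont⟩
  have hG : ∀ x, G x = θ x - Complex.I * (phase c x : ℂ) := fun _ => rfl
  -- The periods of G form a group, so the standard basis vectors suffice for all integer vectors.
  let P : AddSubgroup (ι → ℝ) :=
    { carrier := {v | ∀ x, G (x + v) = G x}
      zero_mem' := fun x => by rw [add_zero]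
      add_mem' := fun {u v} hu hv x => by rw [← add_assoc, hv, hu]
      neg_mem' := fun {u} hu x => by rw [← hu (x + -u), neg_add_cancel_right] }
  have hsingle : ∀ i, (Pi.single i 1 : ι → ℝ) ∈ P := by
    intro i x
    -- Both functions are logarithms of the same function and agree at 0.
    have h1 := eq_of_exp_eq (f := fun x => θ (x + Pi.single i 1))
      (g := fun x => θ x + c i * (2 * Real.pi * Complex.I)) (by fun_prop) (by fun_prop)
      (fun x => by
        rw [hθ, Complex.exp_add, hθ, Complex.exp_eq_one_iff.2 ⟨c i, rfl⟩, mul_one, hcast, hper])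
      (x₀ := 0) (by simp [hc, hθ0])
    have h2 := congrFun h1 x
    rw [hG, hG, h2, phase_add]
    have h3 : phase c (Pi.single i 1) = 2 * Real.pi * c i := by
      simp [phase, Pi.single_apply]
    rw [h3]
    push_cast
    ring
  have hP : ∀ n : ι → ℤ, (fun i => (n i : ℝ)) ∈ P := by
    intro n
    have : (fun i => (n i : ℝ)) = ∑ i, n i • (Pi.single i 1 : ι → ℝ) := by
      rw [pi_eq_sum_univ' (fun i => (n i : ℝ))]
      simp [← Int.cast_smul_eq_zsmul ℝ]
    rw [this]
    exact AddSubgroup.sum_mem _ fun i _ => AddSubgroup.zsmul_mem _ (hsingle i) _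
  have hfac : Function.FactorsThrough G (toTorus ι) := by
    intro x y hxy
    obtain ⟨n, rfl⟩ := toTorus_eq_iff.1 hxy
    exact (hP n x).symm
  have hq := (isOpenQuotientMap_toTorus ι).isQuotientMap
  refine ⟨c, hq.lift G hfac, fun x => ?_⟩
  have : hq.lift G hfac (toTorus ι x) = G x := DFunLike.congr_fun (hq.lift_comp G hfac) x
  rw [this, hG]
  ring

/-- A nonvanishing Hermitian function in the Wiener algebra of the torus which takes the value `1`
at `0` is the exponential of a linear phase and an absolutely convergent Fourier series with real
coefficients. -/
theorem exists_log_series {F : C(UnitAddTorus ι, ℂ)} (hF : wnorm F ≠ ∞) (h0 : ∀ x, F x ≠ 0)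
    (h1 : F 0 = 1) (hconj : ∀ x, F (-x) = conj (F x)) :
    ∃ (c : ι → ℤ) (a : (ι → ℤ) → ℝ), (Summable fun n => |a n|) ∧ ∀ x : ι → ℝ,
      F (toTorus ι x) = Complex.exp (Complex.I * (phase c x : ℂ) +
        ∑' n, (a n : ℂ) * (Complex.exp (Complex.I * (phase n x : ℂ)) - 1)) := by
  obtain ⟨θ, hθ0, hθ⟩ := exists_log_lift h0 h1
  obtain ⟨c, g, hg⟩ := exists_winding hθ0 hθ
  have hgexp : NormedSpace.exp g = mFourier (-c) * F := by
    ext t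
    obtain ⟨x, rfl⟩ := (isOpenQuotientMap_toTorus ι).surjective t
    rw [exp_apply, ContinuousMap.mul_apply, ← hθ, hg, Complex.exp_add, mFourier_neg,
      mFourier_toTorus, ← Complex.exp_conj, ← mul_assoc, ← Complex.exp_add]
    simp
  have hgw : wnorm g ≠ ∞ := wnorm_ne_top_of_exp (by rwa [hgexp, wnorm_mFourier_mul])
  -- By the symmetry of F, the right-hand side is also a continuous logarithm vanishing at 0.
  have hherm : ∀ x, θ x = conj (θ (-x)) := by
    refine congrFun (eq_of_exp_eq (x₀ := 0) θ.continuous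
      (Complex.continuous_conj.comp (θ.continuous.comp continuous_neg)) (fun x => ?_)
      (by simp [hθ0]))
    rw [Complex.exp_conj, hθ, hθ, toTorus_neg, hconj, Complex.conj_conj]
  set a : (ι → ℤ) → ℝ := fun n => (coeff n g).re with ha
  have hasum : Summable fun n => |a n| :=
    Summable.of_nonneg_of_le (fun n => abs_nonneg _) (fun n => Complex.abs_re_le_norm _)
      (summable_coeff hgw)
  have hser : ∀ x, HasSum (fun n => coeff n g * Complex.exp (Complex.I * (phase n x : ℂ)))
      (g (toTorus ι x)) := by
    intro x
    have := (ContinuousMap.evalCLM ℂ (toTorus ι x)).hasSum (hasSum_coeff hgw)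
    convert! this using 2 with n
    simp [mFourier_toTorus]
  have hser2 : ∀ x, HasSum (fun n => conj (coeff n g) * Complex.exp (Complex.I * (phase n x : ℂ)))
      (g (toTorus ι x)) := by
    intro x
    have h2 := (hser (-x)).map (starRingEnd ℂ) Complex.continuous_conj
    have h3 : conj (g (toTorus ι (-x))) = g (toTorus ι x) := by
      have h4 := hherm x
      rw [hg, hg (-x), phase_neg] at h4
      simp only [map_add, map_mul, map_neg, Complex.conj_I, Complex.conj_ofReal,
        Complex.ofReal_neg] at h4
      linear_combination -h4
    rw [h3] at h2
    convert! h2 using 2 with n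
    simp [← Complex.exp_conj, phase_neg]
  -- Averaging the series of g with its conjugate-reflected form, which has the same sum, replaces
  -- the coefficients by their real parts.
  have hser3 : ∀ x, HasSum (fun n => (a n : ℂ) * Complex.exp (Complex.I * (phase n x : ℂ)))
      (g (toTorus ι x)) := by
    intro x
    have h2 := ((hser x).add (hser2 x)).mul_left (1 / 2 : ℂ)
    convert! h2 using 1
    · ext n
      rw [← add_mul, Complex.add_conj, ha]
      push_cast
      ring
    · ring
  have hg0 : g (toTorus ι 0) = 0 := by
    have := hg 0
    rw [hθ0, phase_zero] at this
    simpa using this.symm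
  refine ⟨c, a, hasum, fun x => ?_⟩
  -- Since g vanishes at 0, subtracting the series there produces the terms e^{iφ} - 1.
  have h5 := (hser3 x).sub (hser3 0)
  rw [hg0, sub_zero] at h5
  simp only [phase_zero, Complex.ofReal_zero, mul_zero, Complex.exp_zero, ← mul_sub] at h5
  rw [h5.tsum_eq, ← hg, hθ]

end WienerAlgebra

namespace QuasiID

open Filter
open scoped ComplexConjugate Nat

variable {d : ℕ}

/-! ### Infinitely divisible distributions -/

instance isFiniteMeasure_convPow (p : Measure (EuclideanSpace ℝ (Fin d))) [IsFiniteMeasure p]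
    (n : ℕ) : IsFiniteMeasure (convPow p n) := by
  induction n with
  | zero => exact inferInstanceAs (IsFiniteMeasure (Measure.dirac 0))
  | succ n ih => exact inferInstanceAs (IsFiniteMeasure ((convPow p n).conv p))

lemma charFun_convPow (p : Measure (EuclideanSpace ℝ (Fin d))) [IsFiniteMeasure p] (n : ℕ)
    (z : EuclideanSpace ℝ (Fin d)) : charFun (convPow p n) z = charFun p z ^ n := by
  induction n with
  | zero => simp [convPow, charFun_dirac]
  | succ n ih => rw [convPow, charFun_conv, ih, pow_succ]

lemma convPow_univ (p : Measure (EuclideanSpace ℝ (Fin d))) [IsFiniteMeasure p] (n : ℕ) :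
    convPow p n univ = ENNReal.ofReal (p.real univ ^ n) := by
  have h := charFun_convPow p n 0
  rw [charFun_zero, charFun_zero] at h
  rw [← ofReal_measureReal]
  congr 1
  exact_mod_cast h

/-- The compound Poisson distribution with intensity measure `p`. -/
def compoundPoisson (p : Measure (EuclideanSpace ℝ (Fin d))) :
    Measure (EuclideanSpace ℝ (Fin d)) :=
  Measure.sum fun n : ℕ => ENNReal.ofReal (Real.exp (-p.real univ) / n !) • convPow p n

instance isProbabilityMeasure_compoundPoisson (p : Measure (EuclideanSpace ℝ (Fin d)))
    [IsFiniteMeasure p] : IsProbabilityMeasure (compoundPoisson p) := by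
  refine ⟨?_⟩
  rw [compoundPoisson, Measure.sum_apply _ MeasurableSet.univ]
  have h0 : HasSum (fun n : ℕ => (p.real univ) ^ n / n !) (Real.exp (p.real univ)) := by
    rw [Real.exp_eq_exp_ℝ]
    exact NormedSpace.expSeries_div_hasSum_exp (p.real univ)
  have h1 := h0.mul_left (Real.exp (-p.real univ))
  rw [← Real.exp_add, neg_add_cancel, Real.exp_zero] at h1
  have h2 : ∀ n : ℕ, (ENNReal.ofReal (Real.exp (-p.real univ) / n !) • convPow p n) univ =
      ENNReal.ofReal (Real.exp (-p.real univ) * (p.real univ ^ n / n !)) := by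
    intro n
    rw [Measure.smul_apply, convPow_univ, smul_eq_mul, ← ENNReal.ofReal_mul (by positivity)]
    congr 1
    ring
  rw [tsum_congr h2, ← ENNReal.ofReal_tsum_of_nonneg (fun n => by positivity) h1.summable,
    h1.tsum_eq, ENNReal.ofReal_one]

lemma integrable_cexp_inner (p : Measure (EuclideanSpace ℝ (Fin d))) [IsFiniteMeasure p]
    (z : EuclideanSpace ℝ (Fin d)) :
    Integrable (fun x => Complex.exp ((inner ℝ x z : ℝ) * Complex.I)) p := by
  refine Integrable.of_bound (by fun_prop) 1 (ae_of_all _ fun x => ?_)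
  rw [Complex.norm_exp_ofReal_mul_I]

lemma charFun_compoundPoisson (p : Measure (EuclideanSpace ℝ (Fin d))) [IsFiniteMeasure p]
    (z : EuclideanSpace ℝ (Fin d)) :
    charFun (compoundPoisson p) z = Complex.exp (charFun p z - p.real univ) := by
  have hi := integrable_cexp_inner (compoundPoisson p) z
  rw [charFun_apply, compoundPoisson, integral_sum_measure hi]
  have h1 : ∀ n : ℕ, ∫ x, Complex.exp ((inner ℝ x z : ℝ) * Complex.I)
      ∂(ENNReal.ofReal (Real.exp (-p.real univ) / n !) • convPow p n) =
        Complex.exp (-p.real univ) * (charFun p z ^ n / n !) := by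
    intro n
    rw [integral_smul_measure, ← charFun_apply, charFun_convPow,
      ENNReal.toReal_ofReal (by positivity), Complex.real_smul]
    push_cast
    ring
  have h2 : HasSum (fun n : ℕ => charFun p z ^ n / n !) (Complex.exp (charFun p z)) := by
    rw [Complex.exp_eq_exp_ℂ]
    exact NormedSpace.expSeries_div_hasSum_exp (charFun p z)
  rw [tsum_congr h1, (h2.mul_left _).tsum_eq, ← Complex.exp_add]
  congr 1
  ring

/-- The compound Poisson distribution with intensity measure `p` and drift `c` is infinitely
divisible. -/
lemma isInfinitelyDivisible_drift_conv_compoundPoisson (c : EuclideanSpace ℝ (Fin d))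
    (p : Measure (EuclideanSpace ℝ (Fin d))) [IsFiniteMeasure p] :
    IsInfinitelyDivisible ((Measure.dirac c).conv (compoundPoisson p)) := by
  refine ⟨inferInstance, fun n hn => ?_⟩
  have hn0 : (n : ℂ) ≠ 0 := by
    rw [Nat.cast_ne_zero]
    omega
  -- The n-th convolution root divides both intensity and drift by n.
  set q : Measure (EuclideanSpace ℝ (Fin d)) := ENNReal.ofReal (n : ℝ)⁻¹ • p with hq
  have : IsFiniteMeasure q := Measure.smul_finite _ ENNReal.ofReal_ne_top
  refine ⟨(Measure.dirac ((n : ℝ)⁻¹ • c)).conv (compoundPoisson q), inferInstance, ?_⟩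
  refine Measure.ext_of_charFun (funext fun z => ?_)
  have h1 : charFun q z = (n : ℂ)⁻¹ * charFun p z := by
    rw [charFun_apply, hq, integral_smul_measure, ← charFun_apply,
      ENNReal.toReal_ofReal (by positivity), Complex.real_smul]
    push_cast
    rfl
  have h2 : (q.real univ : ℂ) = (n : ℂ)⁻¹ * p.real univ := by
    rw [hq, measureReal_ennreal_smul_apply, ENNReal.toReal_ofReal (by positivity)]
    push_cast
    rfl
  rw [charFun_convPow, charFun_conv, charFun_conv, charFun_compoundPoisson,
    charFun_compoundPoisson, charFun_dirac, charFun_dirac, ← Complex.exp_add, ← Complex.exp_add,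
    ← Complex.exp_nat_mul, h1, h2, real_inner_smul_left]
  congr 1
  push_cast
  field_simp

/-- |ρ̂|² is the characteristic function of the symmetrisation of ρ, hence an integral of cosines;
then 1 - cos 2t = 2(1 - cos t)(1 + cos t) ≤ 4(1 - cos t) is integrated. -/
lemma one_sub_norm_sq_charFun_two_smul_le (ρ : Measure (EuclideanSpace ℝ (Fin d)))
    [IsProbabilityMeasure ρ] (z : EuclideanSpace ℝ (Fin d)) :
    1 - ‖charFun ρ ((2 : ℝ) • z)‖ ^ 2 ≤ 4 * (1 - ‖charFun ρ z‖ ^ 2) := by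
  set ρ' := ρ.map ((-1 : ℝ) • ·) with hρ'
  have : IsProbabilityMeasure ρ' := Measure.isProbabilityMeasure_map (by fun_prop)
  have h1 : ∀ w, (‖charFun ρ w‖ ^ 2 : ℝ) = (charFun (ρ.conv ρ') w).re := by
    intro w
    rw [charFun_conv, hρ', charFun_map_smul, neg_one_smul, charFun_neg, Complex.mul_conj,
      Complex.normSq_eq_norm_sq, Complex.ofReal_re]
  have hi : ∀ w : EuclideanSpace ℝ (Fin d),
      Integrable (fun x => Real.cos (inner ℝ x w)) (ρ.conv ρ') := fun w =>
    Integrable.of_bound (by fun_prop) 1 (ae_of_all _ fun x => Real.abs_cos_le_one _)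
  have h2 : ∀ w, (charFun (ρ.conv ρ') w).re = ∫ x, Real.cos (inner ℝ x w) ∂(ρ.conv ρ') := by
    intro w
    rw [charFun_apply]
    have := integral_re (integrable_cexp_inner (ρ.conv ρ') w)
    refine Eq.trans this.symm (integral_congr_ae (ae_of_all _ fun x => ?_))
    exact Complex.exp_ofReal_mul_I_re _
  have h3 : ∀ w, 1 - ‖charFun ρ w‖ ^ 2 = ∫ x, (1 - Real.cos (inner ℝ x w)) ∂(ρ.conv ρ') := by
    intro w
    rw [h1, h2, integral_sub (integrable_const _) (hi w)]
    simp
  rw [h3, h3, ← integral_const_mul]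
  refine integral_mono ((integrable_const _).sub (hi _))
    (((integrable_const _).sub (hi _)).const_mul _) fun x => ?_
  simp only [real_inner_smul_right, Real.cos_two_mul]
  nlinarith [Real.cos_le_one (inner ℝ x z), Real.neg_one_le_cos (inner ℝ x z),
    mul_nonneg (sub_nonneg.2 (Real.cos_le_one (inner ℝ x z)))
      (sub_nonneg.2 (Real.cos_le_one (inner ℝ x z)))]

/-- If μ̂(2z) = 0, every convolution root ρ has ρ̂(2z) = 0, so |ρ̂(z)|² ≤ 3/4 by the doubling
inequality. Roots of arbitrarily high order then force μ̂(z) = 0. -/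
lemma IsInfinitelyDivisible.charFun_two_smul_ne_zero {μ : Measure (EuclideanSpace ℝ (Fin d))}
    (h : IsInfinitelyDivisible μ) {z : EuclideanSpace ℝ (Fin d)} (hz : charFun μ z ≠ 0) :
    charFun μ ((2 : ℝ) • z) ≠ 0 := by
  intro h2
  have hpos : 0 < ‖charFun μ z‖ ^ 2 := by positivity
  obtain ⟨n, hn⟩ := exists_pow_lt_of_lt_one hpos (show (3 / 4 : ℝ) < 1 by norm_num)
  obtain ⟨ρ, hρ, hρn⟩ := h.2 (n + 1) (by omega)
  have h3 : charFun ρ ((2 : ℝ) • z) = 0 := by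
    rw [← hρn, charFun_convPow] at h2
    exact pow_eq_zero_iff (by omega) |>.1 h2
  have h4 := one_sub_norm_sq_charFun_two_smul_le ρ z
  rw [h3, norm_zero] at h4
  have h5 : ‖charFun ρ z‖ ^ 2 ≤ 3 / 4 := by linarith
  have h6 : ‖charFun μ z‖ ^ 2 ≤ (3 / 4 : ℝ) ^ (n + 1) := by
    rw [← hρn, charFun_convPow, norm_pow, ← pow_mul, mul_comm, pow_mul]
    gcongr
  have h7 : (3 / 4 : ℝ) ^ (n + 1) ≤ (3 / 4) ^ n :=
    pow_le_pow_of_le_one (by norm_num) (by norm_num) (by omega)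
  linarith

/-- The characteristic function of an infinitely divisible distribution has no zeroes. -/
theorem IsInfinitelyDivisible.charFun_ne_zero {μ : Measure (EuclideanSpace ℝ (Fin d))}
    (h : IsInfinitelyDivisible μ) (z : EuclideanSpace ℝ (Fin d)) : charFun μ z ≠ 0 := by
  have := h.1
  -- Continuity at 0 gives a nonzero value at 2⁻ᵏz for some k, from which k doublings lead back to
  -- z.
  have hlim : Tendsto (fun k : ℕ => charFun μ ((1 / 2 : ℝ) ^ k • z)) atTop (nhds 1) := by
    have h1 : Tendsto (fun k : ℕ => (1 / 2 : ℝ) ^ k • z) atTop (nhds ((0 : ℝ) • z)) :=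
      (tendsto_pow_atTop_nhds_zero_of_lt_one (by norm_num) (by norm_num)).smul_const z
    have h2 := (continuous_charFun (μ := μ)).continuousAt.tendsto.comp h1
    rw [zero_smul, charFun_zero, probReal_univ] at h2
    simpa using! h2
  obtain ⟨k, hk⟩ := (hlim.eventually_ne one_ne_zero).exists
  suffices ∀ j w, charFun μ ((1 / 2 : ℝ) ^ j • w) ≠ 0 → charFun μ w ≠ 0 from this k z hk
  intro j
  induction j with
  | zero => simp
  | succ j ih =>
    intro w hw
    refine ih w ?_
    have := h.charFun_two_smul_ne_zero hw
    rwa [smul_smul, pow_succ', ← mul_assoc, show (2 : ℝ) * (1 / 2) = 1 by norm_num, one_mul] at this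

lemma IsQuasiInfinitelyDivisible.charFun_ne_zero {μ : Measure (EuclideanSpace ℝ (Fin d))}
    (h : IsQuasiInfinitelyDivisible μ) (z : EuclideanSpace ℝ (Fin d)) : charFun μ z ≠ 0 := by
  obtain ⟨-, μ₁, μ₂, h1, h2, h3⟩ := h
  rw [h3]
  exact div_ne_zero (h1.charFun_ne_zero z) (h2.charFun_ne_zero z)

/-! ### Matrices acting on vectors -/

lemma matVec_add (A : Matrix (Fin d) (Fin d) ℝ) (x y : EuclideanSpace ℝ (Fin d)) :
    matVec A (x + y) = matVec A x + matVec A y := by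
  ext i
  simp [matVec, Matrix.mulVec_add]

lemma matVec_neg (A : Matrix (Fin d) (Fin d) ℝ) (x : EuclideanSpace ℝ (Fin d)) :
    matVec A (-x) = -matVec A x := by
  ext i
  simp [matVec, Matrix.mulVec_neg]

lemma continuous_matVec (A : Matrix (Fin d) (Fin d) ℝ) : Continuous (matVec A) := by
  unfold matVec
  fun_prop

lemma inner_matVec_single (A : Matrix (Fin d) (Fin d) ℝ) (i j : Fin d) :
    inner ℝ (EuclideanSpace.single i (1 : ℝ)) (matVec A (EuclideanSpace.single j 1)) = A i j := by
  simp [matVec, EuclideanSpace.inner_single_left]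

/-- A symmetric matrix is determined by its quadratic form. -/
lemma eq_of_inner_matVec_eq {A A' : Matrix (Fin d) (Fin d) ℝ} (hA : A.IsSymm) (hA' : A'.IsSymm)
    (h : ∀ x : EuclideanSpace ℝ (Fin d), inner ℝ x (matVec A x) = inner ℝ x (matVec A' x)) :
    A = A' := by
  ext i j
  have h1 := h (EuclideanSpace.single i 1 + EuclideanSpace.single j 1)
  have h2 := h (EuclideanSpace.single i 1)
  have h3 := h (EuclideanSpace.single j 1)
  simp only [matVec_add, inner_add_left, inner_add_right, inner_matVec_single] at h1 h2 h3
  have h4 := hA.apply i j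
  have h5 := hA'.apply i j
  linarith

/-! ### The Lévy–Khintchine kernel -/

/-- The integrand of the Lévy–Khintchine representation. -/
def lkKernel (z x : EuclideanSpace ℝ (Fin d)) : ℂ :=
  Complex.exp (Complex.I * ((inner ℝ z x : ℝ) : ℂ)) - 1
    - Complex.I * ((inner ℝ z (stdRep x) : ℝ) : ℂ)

lemma measurable_stdRep : Measurable (stdRep : EuclideanSpace ℝ (Fin d) → _) :=
  measurable_id.indicator Metric.isClosed_closedBall.measurableSet

lemma measurable_lkKernel (z : EuclideanSpace ℝ (Fin d)) : Measurable (lkKernel z) := by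
  have := measurable_stdRep (d := d)
  unfold lkKernel
  fun_prop

lemma continuous_lkKernel (x : EuclideanSpace ℝ (Fin d)) : Continuous fun z => lkKernel z x := by
  unfold lkKernel
  fun_prop

@[simp] lemma lkKernel_zero (x : EuclideanSpace ℝ (Fin d)) : lkKernel 0 x = 0 := by
  simp [lkKernel]

lemma stdRep_of_le {x : EuclideanSpace ℝ (Fin d)} (hx : ‖x‖ ≤ 1) : stdRep x = x :=
  indicator_of_mem (by simpa using hx) _

lemma stdRep_of_lt {x : EuclideanSpace ℝ (Fin d)} (hx : 1 < ‖x‖) : stdRep x = 0 :=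
  indicator_of_notMem (by simpa using hx) _

/-- The constant 3 serves |t| ≥ 1, where 2 + |t| ≤ 3t²; for |t| ≤ 1 the Taylor remainder is smaller.
-/
lemma norm_cexp_sub_one_sub_le (t : ℝ) :
    ‖Complex.exp (Complex.I * t) - 1 - Complex.I * t‖ ≤ 3 * t ^ 2 := by
  have hI : ‖Complex.I * (t : ℂ)‖ = |t| := by simp
  rcases le_total |t| 1 with h | h
  · refine (Complex.norm_exp_sub_one_sub_id_le (hI.trans_le h)).trans ?_
    rw [hI, sq_abs]
    nlinarith [sq_nonneg t]
  · have h1 : ‖Complex.exp (Complex.I * t)‖ = 1 := by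
      rw [mul_comm]
      exact Complex.norm_exp_ofReal_mul_I t
    calc _ ≤ ‖Complex.exp (Complex.I * t)‖ + ‖(1 : ℂ)‖ + ‖Complex.I * (t : ℂ)‖ :=
          (norm_sub_le _ _).trans (by gcongr; exact norm_sub_le _ _)
      _ ≤ 3 * t ^ 2 := by
          rw [h1, hI, norm_one, ← sq_abs]
          nlinarith

lemma norm_lkKernel_le (z x : EuclideanSpace ℝ (Fin d)) :
    ‖lkKernel z x‖ ≤ (2 + 3 * ‖z‖ ^ 2) * min 1 (‖x‖ ^ 2) := by
  rcases le_or_gt ‖x‖ 1 with h | h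
  · rw [min_eq_right (by nlinarith [norm_nonneg x]), lkKernel, stdRep_of_le h]
    refine (norm_cexp_sub_one_sub_le _).trans ?_
    have h1 : (inner ℝ z x) ^ 2 ≤ ‖z‖ ^ 2 * ‖x‖ ^ 2 := by
      rw [← mul_pow, ← sq_abs]
      gcongr
      exact abs_real_inner_le_norm z x
    nlinarith [sq_nonneg ‖x‖]
  · rw [min_eq_left (by nlinarith), lkKernel, stdRep_of_lt h, inner_zero_right,
      Complex.ofReal_zero, mul_zero, sub_zero]
    have h1 : ‖Complex.exp (Complex.I * ((inner ℝ z x : ℝ) : ℂ))‖ = 1 := by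
      rw [mul_comm]
      exact Complex.norm_exp_ofReal_mul_I _
    refine (norm_sub_le _ _).trans ?_
    rw [h1, norm_one]
    nlinarith [sq_nonneg ‖z‖]

/-- A measure is of Lévy type if it does not charge the origin and integrates `1 ∧ |x|²`. -/
structure IsLevyType (p : Measure (EuclideanSpace ℝ (Fin d))) : Prop where
  zero : p {0} = 0
  integrable : Integrable (fun x => min 1 (‖x‖ ^ 2)) p

lemma IsLevyType.add {p q : Measure (EuclideanSpace ℝ (Fin d))} (hp : IsLevyType p)
    (hq : IsLevyType q) : IsLevyType (p + q) :=
  ⟨by simp [hp.zero, hq.zero], hp.integrable.add_measure hq.integrable⟩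

lemma PuncturedSignedMeasure.IsQuasiLevyType.posPart {ν : PuncturedSignedMeasure d}
    (h : ν.IsQuasiLevyType) : IsLevyType ν.posPart :=
  ⟨ν.posPart_zero, Integrable.left_of_add_measure h⟩

lemma PuncturedSignedMeasure.IsQuasiLevyType.negPart {ν : PuncturedSignedMeasure d}
    (h : ν.IsQuasiLevyType) : IsLevyType ν.negPart :=
  ⟨ν.negPart_zero, Integrable.right_of_add_measure h⟩

variable {p q : Measure (EuclideanSpace ℝ (Fin d))}

lemma IsLevyType.integrable_lkKernel (hp : IsLevyType p) (z : EuclideanSpace ℝ (Fin d)) :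
    Integrable (lkKernel z) p :=
  (hp.integrable.const_mul (2 + 3 * ‖z‖ ^ 2)).mono' (measurable_lkKernel z).aestronglyMeasurable
    (ae_of_all _ fun x => norm_lkKernel_le z x)

lemma IsLevyType.continuous_integral_lkKernel (hp : IsLevyType p) :
    Continuous fun z => ∫ x, lkKernel z x ∂p := by
  refine continuous_iff_continuousAt.2 fun z₀ => ?_
  refine continuousAt_of_dominated
    (bound := fun x => (2 + 3 * (‖z₀‖ + 1) ^ 2) * min 1 (‖x‖ ^ 2))
    (Eventually.of_forall fun z => (measurable_lkKernel z).aestronglyMeasurable) ?_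
    (hp.integrable.const_mul _) (ae_of_all _ fun x => (continuous_lkKernel x).continuousAt)
  filter_upwards [Metric.ball_mem_nhds z₀ one_pos] with z hz
  refine ae_of_all _ fun x => (norm_lkKernel_le z x).trans ?_
  have : ‖z‖ ≤ ‖z₀‖ + 1 := by
    have h1 := norm_sub_norm_le z z₀
    rw [mem_ball_iff_norm] at hz
    linarith
  gcongr

/-- The density `2 - 2 cos⟨h, x⟩`. -/
def cosDensity (h x : EuclideanSpace ℝ (Fin d)) : ℝ := 2 - 2 * Real.cos (inner ℝ h x)

lemma cosDensity_nonneg (h x : EuclideanSpace ℝ (Fin d)) : 0 ≤ cosDensity h x := by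
  unfold cosDensity
  linarith [Real.cos_le_one (inner ℝ h x)]

lemma measurable_cosDensity (h : EuclideanSpace ℝ (Fin d)) : Measurable (cosDensity h) := by
  unfold cosDensity
  fun_prop

/-- The second difference of the Lévy–Khintchine kernel in the direction `h`. -/
lemma lkKernel_second_difference (z h x : EuclideanSpace ℝ (Fin d)) :
    lkKernel (z + h) x + lkKernel (z - h) x - 2 * lkKernel z x =
      -((cosDensity h x : ℝ) • Complex.exp ((inner ℝ x z : ℝ) * Complex.I)) := by
  have h1 : ((Real.cos (inner ℝ h x) : ℝ) : ℂ) =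
      (Complex.exp (Complex.I * ((inner ℝ h x : ℝ) : ℂ)) +
        Complex.exp (-(Complex.I * ((inner ℝ h x : ℝ) : ℂ)))) / 2 := by
    rw [Complex.ofReal_cos, Complex.cos]
    ring_nf
  rw [Complex.real_smul, cosDensity]
  push_cast
  rw [← Complex.ofReal_cos, h1, real_inner_comm z x]
  simp only [lkKernel, inner_add_left, inner_sub_left]
  push_cast
  rw [mul_add, mul_sub Complex.I, Complex.exp_add, Complex.exp_sub, Complex.exp_neg,
    mul_comm _ Complex.I]
  ring

/-- The density is the norm of the second difference of the integrable kernel, based at 0. -/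
lemma IsLevyType.integrable_cosDensity (hp : IsLevyType p) (h : EuclideanSpace ℝ (Fin d)) :
    Integrable (cosDensity h) p := by
  have h1 := ((hp.integrable_lkKernel (0 + h)).add (hp.integrable_lkKernel (0 - h))).sub
    ((hp.integrable_lkKernel 0).const_mul 2)
  have h2 := h1.norm
  refine h2.congr (ae_of_all _ fun x => ?_)
  have h3 := lkKernel_second_difference 0 h x
  simp only [Pi.add_apply, Pi.sub_apply]
  rw [h3, norm_neg, norm_smul, Complex.norm_exp_ofReal_mul_I, mul_one, Real.norm_of_nonneg
    (cosDensity_nonneg h x)]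

/-- The finite measure with density `2 - 2 cos⟨h, x⟩` with respect to `p`. -/
def cosMeasure (p : Measure (EuclideanSpace ℝ (Fin d))) (h : EuclideanSpace ℝ (Fin d)) :
    Measure (EuclideanSpace ℝ (Fin d)) :=
  p.withDensity fun x => ENNReal.ofReal (cosDensity h x)

lemma IsLevyType.isFiniteMeasure_cosMeasure (hp : IsLevyType p)
    (h : EuclideanSpace ℝ (Fin d)) : IsFiniteMeasure (cosMeasure p h) :=
  isFiniteMeasure_withDensity_ofReal (hp.integrable_cosDensity h).2

lemma IsLevyType.charFun_cosMeasure (hp : IsLevyType p) (h z : EuclideanSpace ℝ (Fin d)) :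
    charFun (cosMeasure p h) z =
      -((∫ x, lkKernel (z + h) x ∂p) + (∫ x, lkKernel (z - h) x ∂p)
        - 2 * ∫ x, lkKernel z x ∂p) := by
  have h1 : Integrable (fun x => lkKernel (z + h) x + lkKernel (z - h) x) p :=
    (hp.integrable_lkKernel _).add (hp.integrable_lkKernel _)
  rw [← integral_add (hp.integrable_lkKernel _) (hp.integrable_lkKernel _), ← integral_const_mul,
    ← integral_sub h1 ((hp.integrable_lkKernel _).const_mul _), ← integral_neg, charFun_apply, cosMeasure,
    integral_withDensity_eq_integral_toReal_smul (measurable_cosDensity h).ennreal_ofReal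
      (ae_of_all _ fun x => ENNReal.ofReal_lt_top)]
  refine integral_congr_ae (ae_of_all _ fun x => ?_)
  simp only [lkKernel_second_difference, neg_neg]
  rw [ENNReal.toReal_ofReal (cosDensity_nonneg h x)]

lemma cosMeasure_zero (p : Measure (EuclideanSpace ℝ (Fin d))) (h : EuclideanSpace ℝ (Fin d)) :
    cosMeasure p h {0} = 0 := by
  rw [cosMeasure, withDensity_apply _ (measurableSet_singleton _),
    lintegral_singleton]
  simp [cosDensity]

/-- Where the density is nonzero it can be divided out. -/
lemma restrict_eq_of_cosMeasure_eq {h : EuclideanSpace ℝ (Fin d)}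
    (hpq : cosMeasure p h = cosMeasure q h) :
    p.restrict {x | cosDensity h x ≠ 0} = q.restrict {x | cosDensity h x ≠ 0} := by
  have hS : MeasurableSet {x | cosDensity h x ≠ 0} :=
    (measurable_cosDensity h) (measurableSet_singleton 0).compl
  have key : ∀ p : Measure (EuclideanSpace ℝ (Fin d)), p.restrict {x | cosDensity h x ≠ 0} =
      ((cosMeasure p h).restrict {x | cosDensity h x ≠ 0}).withDensity
        (fun x => ENNReal.ofReal (cosDensity h x))⁻¹ := by
    intro p
    rw [cosMeasure, restrict_withDensity hS]
    refine (withDensity_inv_same (measurable_cosDensity h).ennreal_ofReal ?_ ?_).symm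
    · filter_upwards [ae_restrict_mem hS] with x hx
      rw [ne_eq, ENNReal.ofReal_eq_zero, not_le]
      exact lt_of_le_of_ne (cosDensity_nonneg h x) (Ne.symm hx)
    · exact ae_of_all _ fun x => ENNReal.ofReal_ne_top
  rw [key p, key q, hpq]

/-- For a nonzero coordinate x_j and n > |x_j|, the direction e_j/(n+1) gives an inner product that
is nonzero and below 1 < 2π in modulus, so its cosine is not 1. Countably many directions therefore
suffice for all x ≠ 0. -/
lemma exists_cosDensity_ne_zero {x : EuclideanSpace ℝ (Fin d)} (hx : x ≠ 0) :
    ∃ i : Fin d × ℕ, cosDensity (EuclideanSpace.single i.1 ((i.2 : ℝ) + 1)⁻¹) x ≠ 0 := by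
  have : ∃ j, x j ≠ 0 := by
    by_contra! hc
    exact hx (by ext j; simp [hc j])
  obtain ⟨j, hj⟩ := this
  obtain ⟨n, hn⟩ := exists_nat_gt |x j|
  refine ⟨(j, n), fun h0 => ?_⟩
  simp only [cosDensity, EuclideanSpace.inner_single_left, conj_trivial] at h0
  have habs : |((n : ℝ) + 1)⁻¹ * x j| < 1 := by
    rw [abs_mul, abs_of_pos (by positivity), inv_mul_lt_iff₀ (by positivity)]
    linarith
  have h1 := abs_lt.1 habs
  have hpi := Real.pi_gt_three
  rw [sub_eq_zero, eq_comm, mul_eq_left₀ two_ne_zero,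
    Real.cos_eq_one_iff_of_lt_of_lt (by linarith) (by linarith)] at h0
  rcases mul_eq_zero.1 h0 with h2 | h2
  · exact (inv_ne_zero (by positivity)) h2
  · exact hj h2

lemma IsLevyType.eq_of_cosMeasure_eq (hp : IsLevyType p) (hq : IsLevyType q)
    (h : ∀ h, cosMeasure p h = cosMeasure q h) : p = q := by
  have hU : (⋃ i : Fin d × ℕ,
      {x : EuclideanSpace ℝ (Fin d) |
        cosDensity (EuclideanSpace.single i.1 ((i.2 : ℝ) + 1)⁻¹) x ≠ 0}) = {0}ᶜ := by
    ext x
    simp only [mem_iUnion, mem_ofPred_eq, mem_compl_iff, mem_singleton_iff]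
    refine ⟨?_, exists_cosDensity_ne_zero⟩
    rintro ⟨i, hi⟩ rfl
    exact hi (by simp [cosDensity])
  have h1 := Measure.restrict_iUnion_congr.2 fun i : Fin d × ℕ =>
    restrict_eq_of_cosMeasure_eq (h (EuclideanSpace.single i.1 ((i.2 : ℝ) + 1)⁻¹))
  rw [hU] at h1
  have h2 : ∀ r : Measure (EuclideanSpace ℝ (Fin d)), r {0} = 0 → r.restrict {0}ᶜ = r :=
    fun r hr => Measure.restrict_eq_self_of_ae_mem (compl_mem_ae_iff.2 hr)
  rwa [h2 p hp.zero, h2 q hq.zero] at h1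

/-! ### Uniqueness of the characteristic triplet -/

/-- The characteristic exponent belonging to a triplet. -/
def lkExponent (A : Matrix (Fin d) (Fin d) ℝ) (ν : PuncturedSignedMeasure d)
    (γ z : EuclideanSpace ℝ (Fin d)) : ℂ :=
  Complex.I * ((inner ℝ γ z : ℝ) : ℂ) - (1 / 2 : ℂ) * ((inner ℝ z (matVec A z) : ℝ) : ℂ)
    + ν.integral (lkKernel z)

lemma continuous_lkExponent (A : Matrix (Fin d) (Fin d) ℝ) {ν : PuncturedSignedMeasure d}
    (hν : ν.IsQuasiLevyType) (γ : EuclideanSpace ℝ (Fin d)) : Continuous (lkExponent A ν γ) := by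
  have h1 := hν.posPart.continuous_integral_lkKernel
  have h2 := hν.negPart.continuous_integral_lkKernel
  have h3 := continuous_matVec A
  unfold lkExponent PuncturedSignedMeasure.integral
  fun_prop

lemma lkExponent_zero (A : Matrix (Fin d) (Fin d) ℝ) (ν : PuncturedSignedMeasure d)
    (γ : EuclideanSpace ℝ (Fin d)) : lkExponent A ν γ 0 = 0 := by
  simp [lkExponent, PuncturedSignedMeasure.integral]

/-- The drift is linear and cancels, the quadratic form leaves a constant in z, and the jump part
becomes characteristic functions of finite measures. -/
lemma lkExponent_second_difference (A : Matrix (Fin d) (Fin d) ℝ) {ν : PuncturedSignedMeasure d}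
    (hν : ν.IsQuasiLevyType) (γ z h : EuclideanSpace ℝ (Fin d)) :
    lkExponent A ν γ (z + h) + lkExponent A ν γ (z - h) - 2 * lkExponent A ν γ z =
      -((inner ℝ h (matVec A h) : ℝ) : ℂ) - charFun (cosMeasure ν.posPart h) z
        + charFun (cosMeasure ν.negPart h) z := by
  rw [hν.posPart.charFun_cosMeasure, hν.negPart.charFun_cosMeasure]
  simp only [lkExponent, PuncturedSignedMeasure.integral, sub_eq_add_neg z h, matVec_add,
    matVec_neg, inner_add_left, inner_add_right, inner_neg_left, inner_neg_right]
  push_cast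
  ring

lemma charFun_add_measure (p q : Measure (EuclideanSpace ℝ (Fin d))) [IsFiniteMeasure p]
    [IsFiniteMeasure q] (z : EuclideanSpace ℝ (Fin d)) :
    charFun (p + q) z = charFun p z + charFun q z := by
  rw [charFun_apply, integral_add_measure (integrable_cexp_inner p z) (integrable_cexp_inner q z)]
  rfl

lemma cosMeasure_add (p q : Measure (EuclideanSpace ℝ (Fin d))) (h : EuclideanSpace ℝ (Fin d)) :
    cosMeasure (p + q) h = cosMeasure p h + cosMeasure q h :=
  withDensity_add_measure _ _ _

/-- A constant added to the characteristic function of a finite measure without mass at `0` is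
determined. -/
lemma eq_of_charFun_add_const_eq [IsFiniteMeasure p] [IsFiniteMeasure q] (hp : p {0} = 0)
    (hq : q {0} = 0) {a b : ℝ} (h : ∀ z, charFun p z + a = charFun q z + b) : a = b ∧ p = q := by
  -- Shifting by c makes both constants nonnegative, hence transforms of multiples of δ₀; the masses
  -- at 0 then identify them.
  set c := |a| + |b| with hc
  have ha : 0 ≤ a + c := by linarith [neg_abs_le a, abs_nonneg b]
  have hb : 0 ≤ b + c := by linarith [neg_abs_le b, abs_nonneg a]
  set δ : Measure (EuclideanSpace ℝ (Fin d)) := Measure.dirac 0 with hδ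
  have hs : ∀ t : ℝ, IsFiniteMeasure (ENNReal.ofReal t • δ) :=
    fun t => Measure.smul_finite _ ENNReal.ofReal_ne_top
  have hcf : ∀ t : ℝ, 0 ≤ t → ∀ z, charFun (ENNReal.ofReal t • δ) z = t := by
    intro t ht z
    rw [charFun_apply, integral_smul_measure, hδ, integral_dirac, ENNReal.toReal_ofReal ht]
    simp
  have h1 : p + ENNReal.ofReal (a + c) • δ = q + ENNReal.ofReal (b + c) • δ := by
    refine Measure.ext_of_charFun (funext fun z => ?_)
    rw [charFun_add_measure, charFun_add_measure, hcf _ ha, hcf _ hb]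
    push_cast
    linear_combination h z
  have h2 : a = b := by
    have h3 := congrArg (fun r : Measure _ => r {0}) h1
    simp only [Measure.add_apply, hp, hq, zero_add, Measure.smul_apply, hδ,
      Measure.dirac_apply' _ (measurableSet_singleton _), smul_eq_mul] at h3
    simp only [indicator_of_mem (mem_singleton _), Pi.one_apply, mul_one] at h3
    rw [ENNReal.ofReal_eq_ofReal_iff ha hb] at h3
    linarith
  refine ⟨h2, Measure.ext_of_charFun (funext fun z => ?_)⟩
  have := h z
  rw [h2] at this
  exact add_right_cancel this

lemma PuncturedSignedMeasure.toFun_eq_sub (ν : PuncturedSignedMeasure d) {r : ℝ} (hr : 0 < r)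
    {B : Set (EuclideanSpace ℝ (Fin d))} (hB : AwayFromZero r B) :
    ν.toFun B = ν.posPart.real B - ν.negPart.real B := by
  rw [← ν.truncate_apply hr hB, SignedMeasure.apply_eq_posPart_real_sub_negPart_real _ hB.1,
    measureReal_def, measureReal_def, measureReal_def, measureReal_def, ν.posPart_apply hr hB,
    ν.negPart_apply hr hB]

/-- The hypothesis avoids differences because both parts may be infinite near 0; on sets away from 0
they are finite and can be subtracted. -/
lemma PuncturedSignedMeasure.eq_of_add_eq_add {ν ν' : PuncturedSignedMeasure d}
    (h : ν.posPart + ν'.negPart = ν'.posPart + ν.negPart) : ν = ν' := by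
  have hfun : ν.toFun = ν'.toFun := by
    funext B
    by_cases hB : ∃ r : ℝ, 0 < r ∧ AwayFromZero r B
    · obtain ⟨r, hr, hB⟩ := hB
      rw [ν.toFun_eq_sub hr hB, ν'.toFun_eq_sub hr hB]
      have hfin : ∀ κ : PuncturedSignedMeasure d, κ.posPart B ≠ ∞ ∧ κ.negPart B ≠ ∞ := fun κ => by
        rw [κ.posPart_apply hr hB, κ.negPart_apply hr hB]
        exact ⟨measure_ne_top _ _, measure_ne_top _ _⟩
      have h1 := congrArg (fun r : Measure _ => r.real B) h
      simp only [measureReal_def, Measure.add_apply] at h1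
      rw [ENNReal.toReal_add (hfin ν).1 (hfin ν').2, ENNReal.toReal_add (hfin ν').1 (hfin ν).2]
        at h1
      simp only [measureReal_def]
      linarith
    · rw [ν.eq_zero' B hB, ν'.eq_zero' B hB]
  cases ν
  cases ν'
  congr

/-- A distribution has at most one characteristic triplet. -/
theorem IsCharTriplet.unique {μ : Measure (EuclideanSpace ℝ (Fin d))}
    {A A' : Matrix (Fin d) (Fin d) ℝ} {ν ν' : PuncturedSignedMeasure d}
    {γ γ' : EuclideanSpace ℝ (Fin d)} (h : IsCharTriplet μ A ν γ)
    (h' : IsCharTriplet μ A' ν' γ') : A' = A ∧ ν' = ν ∧ γ' = γ := by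
  obtain ⟨hA, hν, hμ⟩ := h
  obtain ⟨hA', hν', hμ'⟩ := h'
  have hΨ : lkExponent A ν γ = lkExponent A' ν' γ' :=
    WienerAlgebra.eq_of_exp_eq (x₀ := 0) (continuous_lkExponent A hν γ)
      (continuous_lkExponent A' hν' γ') (fun z => (hμ z).symm.trans (hμ' z))
      (by rw [lkExponent_zero, lkExponent_zero])
  -- Moving the negative parts across turns the equality of signed measures into one of positive
  -- measures.
  have hp := hν.posPart.add hν'.negPart
  have hq := hν'.posPart.add hν.negPart
  have key : ∀ h, (inner ℝ h (matVec A h) : ℝ) = inner ℝ h (matVec A' h) ∧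
      cosMeasure (ν.posPart + ν'.negPart) h = cosMeasure (ν'.posPart + ν.negPart) h := by
    intro h
    have := hp.isFiniteMeasure_cosMeasure h
    have := hq.isFiniteMeasure_cosMeasure h
    have := hν.posPart.isFiniteMeasure_cosMeasure h
    have := hν.negPart.isFiniteMeasure_cosMeasure h
    have := hν'.posPart.isFiniteMeasure_cosMeasure h
    have := hν'.negPart.isFiniteMeasure_cosMeasure h
    refine eq_of_charFun_add_const_eq (cosMeasure_zero _ _) (cosMeasure_zero _ _) fun z => ?_
    have h1 := lkExponent_second_difference A hν γ z h
    have h2 := lkExponent_second_difference A' hν' γ' z h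
    rw [hΨ] at h1
    rw [cosMeasure_add, cosMeasure_add, charFun_add_measure, charFun_add_measure]
    linear_combination h1 - h2
  have hAA := eq_of_inner_matVec_eq hA hA' fun h => (key h).1
  have hνν := PuncturedSignedMeasure.eq_of_add_eq_add
    (hp.eq_of_cosMeasure_eq hq fun h => (key h).2)
  subst hAA hνν
  refine ⟨rfl, rfl, ext_inner_right ℝ fun z => ?_⟩
  have h1 := congrFun hΨ z
  simp only [lkExponent, add_left_inj, sub_left_inj] at h1
  exact_mod_cast (mul_left_cancel₀ Complex.I_ne_zero h1).symm

/-! ### Quasi-Lévy type measures from finite measures -/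

namespace PuncturedSignedMeasure

open scoped Classical in
/-- The restriction of a finite signed measure, given by its Jordan decomposition, to the sets
bounded away from zero. -/
def ofJordan (j : JordanDecomposition (EuclideanSpace ℝ (Fin d))) : PuncturedSignedMeasure d where
  toFun B := if ∃ r : ℝ, 0 < r ∧ AwayFromZero r B then j.toSignedMeasure B else 0
  empty' := by simp
  eq_zero' B hB := if_neg hB
  hasSum' r hr f hf hd := by
    have h1 : ∀ i, ∃ r : ℝ, 0 < r ∧ AwayFromZero r (f i) := fun i => ⟨r, hr, hf i⟩
    have h2 : ∃ r : ℝ, 0 < r ∧ AwayFromZero r (⋃ i, f i) :=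
      ⟨r, hr, MeasurableSet.iUnion fun i => (hf i).1, iUnion_subset fun i => (hf i).2⟩
    simp only [h1, h2, if_true]
    exact j.toSignedMeasure.m_iUnion (fun i => (hf i).1) hd

lemma ofJordan_apply (j : JordanDecomposition (EuclideanSpace ℝ (Fin d))) {r : ℝ} (hr : 0 < r)
    {B : Set (EuclideanSpace ℝ (Fin d))} (hB : AwayFromZero r B) :
    (ofJordan j).toFun B = j.toSignedMeasure B :=
  if_pos ⟨r, hr, hB⟩

/-- Restriction preserves mutual singularity, so uniqueness of the Jordan decomposition applies. -/
lemma truncate_ofJordan (j : JordanDecomposition (EuclideanSpace ℝ (Fin d))) {r : ℝ}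
    (hr : 0 < r) :
    ((ofJordan j).truncate r hr).toJordanDecomposition.posPart =
        j.posPart.restrict {x | r ≤ ‖x‖} ∧
      ((ofJordan j).truncate r hr).toJordanDecomposition.negPart =
        j.negPart.restrict {x | r ≤ ‖x‖} := by
  let t : JordanDecomposition (EuclideanSpace ℝ (Fin d)) :=
    { posPart := j.posPart.restrict {x | r ≤ ‖x‖}
      negPart := j.negPart.restrict {x | r ≤ ‖x‖}
      mutuallySingular := (j.mutuallySingular.restrict _).symm.restrict _ |>.symm }
  have key : ((ofJordan j).truncate r hr).toJordanDecomposition = t := by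
    apply SignedMeasure.toJordanDecomposition_eq
    ext B hB
    have hC : MeasurableSet (B ∩ {x : EuclideanSpace ℝ (Fin d) | r ≤ ‖x‖}) :=
      hB.inter (measurableSet_ge r)
    rw [truncate_def, if_pos hB, ofJordan_apply j hr ⟨hC, inter_subset_right⟩,
      JordanDecomposition.toSignedMeasure, JordanDecomposition.toSignedMeasure,
      Measure.toSignedMeasure_sub_apply hB, Measure.toSignedMeasure_sub_apply hC]
    simp only [t, measureReal_restrict_apply hB]
  exact ⟨congrArg JordanDecomposition.posPart key, congrArg JordanDecomposition.negPart key⟩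

lemma posPart_ofJordan (j : JordanDecomposition (EuclideanSpace ℝ (Fin d)))
    (h : j.posPart {0} = 0) : (ofJordan j).posPart = j.posPart :=
  eq_of_agree _ _ (posPart_zero _) h fun r hr B hB => by
    rw [posPart_apply _ hr hB, (truncate_ofJordan j hr).1, Measure.restrict_apply hB.1,
      inter_eq_left.2 hB.2]

lemma negPart_ofJordan (j : JordanDecomposition (EuclideanSpace ℝ (Fin d)))
    (h : j.negPart {0} = 0) : (ofJordan j).negPart = j.negPart :=
  eq_of_agree _ _ (negPart_zero _) h fun r hr B hB => by
    rw [negPart_apply _ hr hB, (truncate_ofJordan j hr).2, Measure.restrict_apply hB.1,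
      inter_eq_left.2 hB.2]

end PuncturedSignedMeasure

/-! ### Lattices -/

/-- The lattice point `M k`. -/
def latticePoint (M : Matrix (Fin d) (Fin d) ℝ) (k : Fin d → ℤ) : EuclideanSpace ℝ (Fin d) :=
  matVec M (WithLp.toLp 2 fun i => (k i : ℝ))

lemma latticePoint_zero (M : Matrix (Fin d) (Fin d) ℝ) : latticePoint M 0 = 0 := by
  ext i
  simp [latticePoint, matVec, Matrix.mulVec, dotProduct]

lemma latticePoint_injective {M : Matrix (Fin d) (Fin d) ℝ} (hM : IsUnit M.det) :
    Function.Injective (latticePoint M) := by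
  intro k l h
  have h1 : M.mulVec (fun i => (k i : ℝ)) = M.mulVec fun i => (l i : ℝ) :=
    congrArg WithLp.ofLp h
  have h2 := Matrix.mulVec_injective_of_isUnit ((Matrix.isUnit_iff_isUnit_det M).2 hM) h1
  exact funext fun i => by exact_mod_cast congrFun h2 i

lemma lattice_eq_range (M : Matrix (Fin d) (Fin d) ℝ) (b : EuclideanSpace ℝ (Fin d)) :
    lattice M b = range fun k => latticePoint M k + b := by
  ext x
  simp only [lattice, mem_ofPred_eq, mem_range, latticePoint, eq_comm]

/-- The torus coordinates `(2π)⁻¹ Mᵀ z`. -/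
def torusCoord (M : Matrix (Fin d) (Fin d) ℝ) (z : EuclideanSpace ℝ (Fin d)) : Fin d → ℝ :=
  fun i => (2 * Real.pi)⁻¹ * M.transpose.mulVec (WithLp.ofLp z) i

lemma inner_latticePoint (M : Matrix (Fin d) (Fin d) ℝ) (k : Fin d → ℤ)
    (z : EuclideanSpace ℝ (Fin d)) :
    inner ℝ (latticePoint M k) z = WienerAlgebra.phase k (torusCoord M z) := by
  have hpi := Real.pi_pos.ne'
  have h1 : inner ℝ (latticePoint M k) z =
      dotProduct (WithLp.ofLp z) (M.mulVec fun i => (k i : ℝ)) := by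
    simp [latticePoint, matVec, EuclideanSpace.inner_eq_star_dotProduct]
  rw [h1, Matrix.dotProduct_mulVec, ← Matrix.mulVec_transpose, WienerAlgebra.phase, dotProduct,
    Finset.mul_sum]
  refine Finset.sum_congr rfl fun i _ => ?_
  rw [torusCoord]
  field_simp

lemma torusCoord_neg (M : Matrix (Fin d) (Fin d) ℝ) (z : EuclideanSpace ℝ (Fin d)) :
    torusCoord M (-z) = -torusCoord M z := by
  ext i
  simp [torusCoord, Matrix.mulVec_neg]

lemma torusCoord_zero (M : Matrix (Fin d) (Fin d) ℝ) : torusCoord M 0 = 0 := by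
  ext i
  simp [torusCoord]

/-- Serves to represent every torus point by a z in the image of a cube of side 2π. -/
lemma torusCoord_matVec {M : Matrix (Fin d) (Fin d) ℝ} (hM : IsUnit M.det) (x : Fin d → ℝ) :
    torusCoord M (matVec (M.transpose)⁻¹ (WithLp.toLp 2 fun i => 2 * Real.pi * x i)) = x := by
  have hpi := Real.pi_pos.ne'
  have hMt : IsUnit M.transpose.det := by rwa [Matrix.det_transpose]
  ext i
  simp only [torusCoord, matVec]
  rw [Matrix.mulVec_mulVec, Matrix.mul_nonsing_inv _ hMt, Matrix.one_mulVec]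
  field_simp

/-! ### Distributions on lattices -/

/-- The atoms of a distribution on the lattice. -/
def atom (μ : Measure (EuclideanSpace ℝ (Fin d))) (M : Matrix (Fin d) (Fin d) ℝ)
    (b : EuclideanSpace ℝ (Fin d)) (k : Fin d → ℤ) : ℝ≥0∞ := μ {latticePoint M k + b}

variable {μ : Measure (EuclideanSpace ℝ (Fin d))} {M : Matrix (Fin d) (Fin d) ℝ}
  {b : EuclideanSpace ℝ (Fin d)}

lemma eq_sum_atom (hM : IsUnit M.det) (hμ : μ (lattice M b)ᶜ = 0) :
    μ = Measure.sum fun k => atom μ M b k • Measure.dirac (latticePoint M k + b) := by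
  have h1 : μ.restrict (lattice M b) = μ := Measure.restrict_eq_self_of_ae_mem hμ
  have h2 : lattice M b = ⋃ k, {latticePoint M k + b} := by
    rw [lattice_eq_range]
    ext x
    simp [eq_comm]
  have hd : Pairwise (Function.onFun Disjoint
      fun k : Fin d → ℤ => ({latticePoint M k + b} : Set (EuclideanSpace ℝ (Fin d)))) := by
    intro k l hkl
    rw [Function.onFun, disjoint_singleton]
    exact fun h => hkl (latticePoint_injective hM (add_right_cancel h))
  conv_lhs => rw [← h1, h2, Measure.restrict_iUnion hd fun k => measurableSet_singleton _]
  simp only [Measure.restrict_singleton]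
  rfl

lemma tsum_atom [IsProbabilityMeasure μ] (hM : IsUnit M.det) (hμ : μ (lattice M b)ᶜ = 0) :
    ∑' k, atom μ M b k = 1 := by
  have h1 := congrArg (fun r : Measure _ => r univ) (eq_sum_atom hM hμ)
  simp only [measure_univ] at h1
  rw [Measure.sum_apply _ MeasurableSet.univ] at h1
  simpa using h1.symm

/-- F is the Fourier series whose coefficients are the atoms of μ; their summability puts it in the
Wiener algebra. -/
lemma charFun_eq_torus [IsProbabilityMeasure μ] (hM : IsUnit M.det)
    (hμ : μ (lattice M b)ᶜ = 0) :
    ∃ F : C(UnitAddTorus (Fin d), ℂ), WienerAlgebra.wnorm F ≠ ∞ ∧ ∀ z,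
      charFun μ z = Complex.exp (Complex.I * ((inner ℝ b z : ℝ) : ℂ)) *
        F (WienerAlgebra.toTorus (Fin d) (torusCoord M z)) := by
  have ht := tsum_atom hM hμ
  have hfin : ∀ k, atom μ M b k ≠ ∞ := fun k => measure_ne_top _ _
  have hs : Summable fun k => (atom μ M b k).toReal :=
    ENNReal.summable_toReal (by rw [ht]; exact ENNReal.one_ne_top)
  have hsF : Summable fun k => ((atom μ M b k).toReal : ℂ) •
      (UnitAddTorus.mFourier k : C(UnitAddTorus (Fin d), ℂ)) := by
    refine Summable.of_norm ?_
    simpa [norm_smul, UnitAddTorus.mFourier_norm] using hs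
  refine ⟨∑' k, ((atom μ M b k).toReal : ℂ) • UnitAddTorus.mFourier k, ?_, fun z => ?_⟩
  · refine ne_top_of_le_ne_top ?_ (WienerAlgebra.wnorm_le_of_hasSum hsF.hasSum)
    simp only [WienerAlgebra.wnorm_smul, WienerAlgebra.wnorm_mFourier, mul_one]
    rw [tsum_enorm_ne_top_iff_summable_norm]
    simpa using hs
  · have h1 := (ContinuousMap.evalCLM ℂ (WienerAlgebra.toTorus (Fin d) (torusCoord M z))).hasSum
      hsF.hasSum
    have h2 := h1.mul_left (Complex.exp (Complex.I * ((inner ℝ b z : ℝ) : ℂ)))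
    rw [charFun_apply]
    conv_lhs => rw [eq_sum_atom hM hμ]
    rw [integral_sum_dirac hfin]
    refine Eq.trans (tsum_congr fun k => ?_) h2.tsum_eq
    simp only [map_smul, ContinuousMap.evalCLM_apply, WienerAlgebra.mFourier_toTorus]
    rw [← inner_latticePoint, inner_add_left, Complex.real_smul, smul_eq_mul]
    push_cast
    rw [add_mul, Complex.exp_add, mul_comm Complex.I, mul_comm Complex.I]
    ring

/-- The characteristic function of a lattice distribution without zeroes is the exponential of a
trigonometric series with real coefficients. -/
lemma exists_charFun_eq_exp [IsProbabilityMeasure μ] (hM : IsUnit M.det)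
    (hμ : μ (lattice M b)ᶜ = 0)
    (h0 : ∀ x : EuclideanSpace ℝ (Fin d), (∀ i, x i ∈ Icc 0 (2 * Real.pi)) →
      charFun μ (matVec (M.transpose)⁻¹ x) ≠ 0) :
    ∃ (c : Fin d → ℤ) (a : (Fin d → ℤ) → ℝ), (Summable fun k => |a k|) ∧ a 0 = 0 ∧ ∀ z,
      charFun μ z = Complex.exp (Complex.I * ((inner ℝ (latticePoint M c + b) z : ℝ) : ℂ) +
        ∑' k, (a k : ℂ) *
          (Complex.exp (Complex.I * ((inner ℝ z (latticePoint M k) : ℝ) : ℂ)) - 1)) := by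
  obtain ⟨F, hFw, hF⟩ := charFun_eq_torus hM hμ
  have hpi := Real.pi_pos
  have hF' : ∀ z, F (WienerAlgebra.toTorus (Fin d) (torusCoord M z)) =
      Complex.exp (-(Complex.I * ((inner ℝ b z : ℝ) : ℂ))) * charFun μ z := by
    intro z
    rw [hF, ← mul_assoc, ← Complex.exp_add, neg_add_cancel, Complex.exp_zero, one_mul]
  have hsurj := (WienerAlgebra.isOpenQuotientMap_toTorus (Fin d)).surjective
  have hne : ∀ t, F t ≠ 0 := by
    intro t
    obtain ⟨x, rfl⟩ := hsurj t
    -- Fractional parts move the point into the unit cube, where the hypothesis on μ̂ applies.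
    have h1 : WienerAlgebra.toTorus (Fin d) x =
        WienerAlgebra.toTorus (Fin d) fun i => Int.fract (x i) := by
      refine WienerAlgebra.toTorus_eq_iff.2 ⟨fun i => -⌊x i⌋, funext fun i => ?_⟩
      simp [Int.fract, sub_eq_add_neg]
    rw [h1, ← torusCoord_matVec hM (fun i => Int.fract (x i)), hF']
    refine mul_ne_zero (Complex.exp_ne_zero _) (h0 _ fun i => ⟨?_, ?_⟩)
    · exact mul_nonneg (by positivity) (Int.fract_nonneg _)
    · exact mul_le_of_le_one_right (by positivity) (Int.fract_lt_one _).le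
  have hone : F 0 = 1 := by
    have h1 := hF' 0
    rw [torusCoord_zero, charFun_zero] at h1
    refine Eq.trans ?_ (h1.trans (by simp))
    rfl
  have hconj : ∀ t, F (-t) = conj (F t) := by
    intro t
    obtain ⟨x, rfl⟩ := hsurj t
    rw [← torusCoord_matVec hM x, ← WienerAlgebra.toTorus_neg, ← torusCoord_neg, hF', hF',
      charFun_neg, map_mul, ← Complex.exp_conj]
    simp
  obtain ⟨c, a, ha, hca⟩ := WienerAlgebra.exists_log_series hFw hne hone hconj
  -- The coefficient at k = 0 multiplies e⁰ - 1 = 0; deleting it keeps the quasi-Lévy measure off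
  -- the origin.
  refine ⟨c, Function.update a 0 0, ?_, by simp, fun z => ?_⟩
  · refine Summable.of_nonneg_of_le (fun k => abs_nonneg _) (fun k => ?_) ha
    by_cases hk : k = 0
    · subst hk; simp
    · simp [hk]
  · rw [hF, hca, ← Complex.exp_add, inner_add_left, inner_latticePoint, ← add_assoc]
    push_cast
    congr 2
    · ring
    · refine tsum_congr fun k => ?_
      by_cases hk : k = 0
      · subst hk; simp [latticePoint_zero, WienerAlgebra.phase]
      · rw [Function.update_of_ne hk, real_inner_comm, inner_latticePoint]

/-- The measure with mass `(w k)⁺` at the lattice point `M k`. -/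
def latticeMeasure (M : Matrix (Fin d) (Fin d) ℝ) (w : (Fin d → ℤ) → ℝ) :
    Measure (EuclideanSpace ℝ (Fin d)) :=
  Measure.sum fun k => ENNReal.ofReal (w k) • Measure.dirac (latticePoint M k)

lemma isFiniteMeasure_latticeMeasure {w : (Fin d → ℤ) → ℝ} (hw : Summable fun k => |w k|) :
    IsFiniteMeasure (latticeMeasure M w) := by
  refine ⟨?_⟩
  rw [latticeMeasure, Measure.sum_apply _ MeasurableSet.univ]
  simp only [Measure.smul_apply, measure_univ, smul_eq_mul, mul_one]
  exact (ENNReal.tsum_le_tsum fun k => ENNReal.ofReal_le_ofReal (le_abs_self (w k))).trans_lt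
    hw.tsum_ofReal_lt_top

lemma latticeMeasure_apply_eq_zero {w : (Fin d → ℤ) → ℝ} {B : Set (EuclideanSpace ℝ (Fin d))}
    (hB : MeasurableSet B) (h : ∀ k, 0 < w k → latticePoint M k ∉ B) :
    latticeMeasure M w B = 0 := by
  rw [latticeMeasure, Measure.sum_apply _ hB, ENNReal.tsum_eq_zero]
  intro k
  rw [Measure.smul_apply, Measure.dirac_apply' _ hB, smul_eq_mul]
  rcases le_or_gt (w k) 0 with hk | hk
  · rw [ENNReal.ofReal_of_nonpos hk, zero_mul]
  · rw [indicator_of_notMem (h k hk), mul_zero]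

lemma hasSum_integral_latticeMeasure {w : (Fin d → ℤ) → ℝ} (hw : Summable fun k => |w k|)
    {f : EuclideanSpace ℝ (Fin d) → ℂ} {C : ℝ} (hf : ∀ x, ‖f x‖ ≤ C) :
    HasSum (fun k => ((max (w k) 0 : ℝ) : ℂ) * f (latticePoint M k))
      (∫ x, f x ∂latticeMeasure M w) := by
  have h1 := hasSum_integral_sum_dirac (f := f) (x := latticePoint M)
    (c := fun k => ENNReal.ofReal (w k)) (fun k => ENNReal.ofReal_ne_top) ?_
  · simpa only [ENNReal.toReal_ofReal', Complex.real_smul] using! h1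
  · refine Summable.of_nonneg_of_le (fun k => by positivity) (fun k => ?_) (hw.mul_right C)
    rw [ENNReal.toReal_ofReal']
    gcongr
    · exact max_le (le_abs_self _) (abs_nonneg _)
    · exact hf _

lemma integral_latticeMeasure_sub {w : (Fin d → ℤ) → ℝ} (hw : Summable fun k => |w k|)
    {f : EuclideanSpace ℝ (Fin d) → ℂ} {C : ℝ} (hf : ∀ x, ‖f x‖ ≤ C) :
    (∫ x, f x ∂latticeMeasure M w) - ∫ x, f x ∂latticeMeasure M (-w) =
      ∑' k, (w k : ℂ) * f (latticePoint M k) := by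
  have hw' : Summable fun k => |(-w) k| := by simpa using hw
  have h1 := (hasSum_integral_latticeMeasure (M := M) hw hf).sub
    (hasSum_integral_latticeMeasure (M := M) hw' hf)
  rw [← h1.tsum_eq]
  refine tsum_congr fun k => ?_
  rw [← sub_mul, ← Complex.ofReal_sub, Pi.neg_apply, max_zero_sub_max_neg_zero_eq_self]

/-- The Jordan decomposition of the signed measure with masses `w k` at the points `M k`. -/
def latticeJordan (hM : IsUnit M.det) {w : (Fin d → ℤ) → ℝ} (hw : Summable fun k => |w k|) :
    JordanDecomposition (EuclideanSpace ℝ (Fin d)) where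
  posPart := latticeMeasure M w
  negPart := latticeMeasure M (-w)
  posPart_finite := isFiniteMeasure_latticeMeasure hw
  negPart_finite := isFiniteMeasure_latticeMeasure (by simpa using hw)
  mutuallySingular := by
    -- The image of the positive indices separates the two measures, because distinct k give
    -- distinct points Mk.
    have hS : MeasurableSet (latticePoint M '' {k | 0 < w k}) :=
      ((to_countable _).image _).measurableSet
    refine ⟨(latticePoint M '' {k | 0 < w k})ᶜ, hS.compl, ?_, ?_⟩
    · exact latticeMeasure_apply_eq_zero hS.compl fun k hk h => h ⟨k, hk, rfl⟩
    · rw [compl_compl]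
      refine latticeMeasure_apply_eq_zero hS fun k hk => ?_
      rintro ⟨l, hl, hlk⟩
      rw [latticePoint_injective hM hlk] at hl
      have h1 : 0 < w k := hl
      rw [Pi.neg_apply] at hk
      linarith

lemma norm_stdRep_le (x : EuclideanSpace ℝ (Fin d)) : ‖stdRep x‖ ≤ 1 := by
  rcases le_or_gt ‖x‖ 1 with h | h
  · rwa [stdRep_of_le h]
  · simp [stdRep_of_lt h]

lemma integrable_stdRep (p : Measure (EuclideanSpace ℝ (Fin d))) [IsFiniteMeasure p] :
    Integrable stdRep p :=
  Integrable.of_bound measurable_stdRep.aestronglyMeasurable 1 (ae_of_all _ norm_stdRep_le)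

lemma norm_cexp_inner_sub_one_le (z x : EuclideanSpace ℝ (Fin d)) :
    ‖Complex.exp (Complex.I * ((inner ℝ z x : ℝ) : ℂ)) - 1‖ ≤ 2 := by
  refine (norm_sub_le _ _).trans ?_
  rw [mul_comm, Complex.norm_exp_ofReal_mul_I, norm_one]
  norm_num

lemma integrable_cexp_inner_sub_one (p : Measure (EuclideanSpace ℝ (Fin d))) [IsFiniteMeasure p]
    (z : EuclideanSpace ℝ (Fin d)) :
    Integrable (fun x => Complex.exp (Complex.I * ((inner ℝ z x : ℝ) : ℂ)) - 1) p :=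
  Integrable.of_bound (by fun_prop) 2 (ae_of_all _ (norm_cexp_inner_sub_one_le z))

lemma charFun_sub_mass (p : Measure (EuclideanSpace ℝ (Fin d))) [IsFiniteMeasure p]
    (z : EuclideanSpace ℝ (Fin d)) :
    charFun p z - p.real univ =
      ∫ x, (Complex.exp (Complex.I * ((inner ℝ z x : ℝ) : ℂ)) - 1) ∂p := by
  have h1 := integrable_cexp_inner p z
  simp only [real_inner_comm z, mul_comm _ Complex.I] at h1
  rw [integral_sub h1 (integrable_const _), charFun_apply, integral_const, Complex.real_smul,
    mul_one]
  simp only [real_inner_comm z, mul_comm _ Complex.I]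

/-- For a finite measure the compensator is integrable on its own; splitting it off is the passage
from γ to the drift. -/
lemma integral_lkKernel_eq (p : Measure (EuclideanSpace ℝ (Fin d))) [IsFiniteMeasure p]
    (z : EuclideanSpace ℝ (Fin d)) :
    ∫ x, lkKernel z x ∂p = (∫ x, (Complex.exp (Complex.I * ((inner ℝ z x : ℝ) : ℂ)) - 1) ∂p)
      - Complex.I * ((inner ℝ z (∫ x, stdRep x ∂p) : ℝ) : ℂ) := by
  have h1 : Integrable (fun x => Complex.I * ((inner ℝ z (stdRep x) : ℝ) : ℂ)) p :=
    ((integrable_stdRep p).const_inner z).ofReal.const_mul _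
  rw [← integral_inner (integrable_stdRep p), ← integral_complex_ofReal, ← integral_const_mul,
    ← integral_sub (integrable_cexp_inner_sub_one p z) h1]
  rfl

/-- A lattice distribution whose characteristic function is the exponential of a trigonometric
series with real coefficients is quasi-infinitely divisible. -/
lemma isQuasiInfinitelyDivisible_of_charFun_eq_exp [IsProbabilityMeasure μ]
    {a : (Fin d → ℤ) → ℝ} (ha : Summable fun k => |a k|) {β : EuclideanSpace ℝ (Fin d)}
    (h : ∀ z, charFun μ z = Complex.exp (Complex.I * ((inner ℝ β z : ℝ) : ℂ) +
      ∑' k, (a k : ℂ) *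
        (Complex.exp (Complex.I * ((inner ℝ z (latticePoint M k) : ℝ) : ℂ)) - 1))) :
    IsQuasiInfinitelyDivisible μ := by
  have := isFiniteMeasure_latticeMeasure (M := M) ha
  have := isFiniteMeasure_latticeMeasure (M := M) (w := -a) (by simpa using ha)
  -- Positive coefficients and the whole drift go to the numerator, negative coefficients to the
  -- denominator.
  refine ⟨inferInstance, _, _,
    isInfinitelyDivisible_drift_conv_compoundPoisson β (latticeMeasure M a),
    isInfinitelyDivisible_drift_conv_compoundPoisson 0 (latticeMeasure M (-a)), fun z => ?_⟩
  rw [h, charFun_conv, charFun_conv, charFun_compoundPoisson, charFun_compoundPoisson,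
    charFun_dirac, charFun_dirac, charFun_sub_mass, charFun_sub_mass,
    ← integral_latticeMeasure_sub ha (norm_cexp_inner_sub_one_le z), inner_zero_left,
    Complex.ofReal_zero, zero_mul, Complex.exp_zero, one_mul, ← Complex.exp_add,
    ← Complex.exp_sub]
  congr 1
  ring

/-- The characteristic triplet of a lattice distribution whose characteristic function is the
exponential of a trigonometric series with real coefficients. -/
lemma exists_isCharTriplet_of_charFun_eq_exp (hM : IsUnit M.det)
    {a : (Fin d → ℤ) → ℝ} (ha : Summable fun k => |a k|) (ha0 : a 0 = 0)
    {β : EuclideanSpace ℝ (Fin d)}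
    (h : ∀ z, charFun μ z = Complex.exp (Complex.I * ((inner ℝ β z : ℝ) : ℂ) +
      ∑' k, (a k : ℂ) *
        (Complex.exp (Complex.I * ((inner ℝ z (latticePoint M k) : ℝ) : ℂ)) - 1))) :
    ∃ (ν : PuncturedSignedMeasure d) (γ : EuclideanSpace ℝ (Fin d)), IsCharTriplet μ 0 ν γ ∧
      IsFiniteMeasure ν.totalVariation ∧ ν.totalVariation (lattice M 0 \ {0})ᶜ = 0 ∧
      ν.IntegrableFun stdRep ∧ drift ν γ = β := by
  have hfp := isFiniteMeasure_latticeMeasure (M := M) ha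
  have hfn := isFiniteMeasure_latticeMeasure (M := M) (w := -a) (by simpa using ha)
  have hmeas : MeasurableSet (lattice M 0 \ {0})ᶜ := by
    rw [lattice_eq_range]
    exact ((countable_range _).mono sdiff_subset).measurableSet.compl
  have hsupp : ∀ w : (Fin d → ℤ) → ℝ, w 0 = 0 →
      latticeMeasure M w (lattice M 0 \ {0})ᶜ = 0 := by
    intro w hw0
    refine latticeMeasure_apply_eq_zero hmeas fun k hk hk' => hk' ⟨?_, fun hk0 => ?_⟩
    · rw [lattice_eq_range]
      exact ⟨k, add_zero _⟩
    · rw [latticePoint_injective hM (hk0.trans (latticePoint_zero M).symm), hw0] at hk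
      exact lt_irrefl _ hk
  have hzero : ∀ w : (Fin d → ℤ) → ℝ, w 0 = 0 → latticeMeasure M w {0} = 0 := fun w hw0 =>
    measure_mono_null (by simp) (hsupp w hw0)
  set ν := PuncturedSignedMeasure.ofJordan (latticeJordan hM ha) with hν
  have hpos : ν.posPart = latticeMeasure M a :=
    PuncturedSignedMeasure.posPart_ofJordan (latticeJordan hM ha) (hzero a ha0)
  have hneg : ν.negPart = latticeMeasure M (-a) :=
    PuncturedSignedMeasure.negPart_ofJordan (latticeJordan hM ha) (hzero (-a) (by simp [ha0]))
  have htv : ν.totalVariation = latticeMeasure M a + latticeMeasure M (-a) := by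
    rw [PuncturedSignedMeasure.totalVariation, hpos, hneg]
  have hfin : IsFiniteMeasure ν.totalVariation := by
    rw [htv]
    infer_instance
  -- γ is chosen so that subtracting the compensator leaves the drift β.
  refine ⟨ν, β + ν.integral stdRep, ⟨Matrix.isSymm_zero, ?_, fun z => ?_⟩, hfin, ?_,
    integrable_stdRep _, add_sub_cancel_right _ _⟩
  · refine Integrable.of_bound (by fun_prop) 1 (ae_of_all _ fun x => ?_)
    rw [Real.norm_of_nonneg (by positivity)]
    exact min_le_left _ _
  · have hint : ν.integral (lkKernel z) =
        (∑' k, (a k : ℂ) *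
          (Complex.exp (Complex.I * ((inner ℝ z (latticePoint M k) : ℝ) : ℂ)) - 1))
          - Complex.I * ((inner ℝ z (ν.integral stdRep) : ℝ) : ℂ) := by
      rw [PuncturedSignedMeasure.integral, PuncturedSignedMeasure.integral, hpos, hneg,
        integral_lkKernel_eq, integral_lkKernel_eq,
        ← integral_latticeMeasure_sub ha (norm_cexp_inner_sub_one_le z), inner_sub_right]
      push_cast
      ring
    have hA : matVec (0 : Matrix (Fin d) (Fin d) ℝ) z = 0 := by
      ext i
      simp [matVec]
    change _ = Complex.exp (_ - _ + ν.integral (lkKernel z))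
    rw [h, hint, hA, inner_zero_right, inner_add_left, real_inner_comm z (ν.integral stdRep)]
    congr 1
    push_cast
    ring
  · rw [htv, Measure.add_apply, hsupp a ha0, hsupp (-a) (by simp [ha0]), add_zero]

end QuasiID

end

theorem corollary3p3 (d : ℕ) (M : Matrix (Fin d) (Fin d) ℝ) (hM : IsUnit M.det)
    (b : EuclideanSpace ℝ (Fin d)) (μ : MeasureTheory.Measure (EuclideanSpace ℝ (Fin d)))
    [MeasureTheory.IsProbabilityMeasure μ] (hμ : μ (QuasiID.lattice M b)ᶜ = 0) :
    (QuasiID.IsQuasiInfinitelyDivisible μ ↔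
      ∀ x : EuclideanSpace ℝ (Fin d), (∀ i, x i ∈ Set.Icc 0 (2 * Real.pi)) →
        MeasureTheory.charFun μ (QuasiID.matVec (M.transpose)⁻¹ x) ≠ 0) ∧
    (QuasiID.IsQuasiInfinitelyDivisible μ →
      ∃ (A : Matrix (Fin d) (Fin d) ℝ) (ν : QuasiID.PuncturedSignedMeasure d)
        (γ : EuclideanSpace ℝ (Fin d)),
        QuasiID.IsCharTriplet μ A ν γ ∧
        (∀ (A' : Matrix (Fin d) (Fin d) ℝ) (ν' : QuasiID.PuncturedSignedMeasure d)
          (γ' : EuclideanSpace ℝ (Fin d)),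
          QuasiID.IsCharTriplet μ A' ν' γ' → A' = A ∧ ν' = ν ∧ γ' = γ) ∧
        A = 0 ∧
        MeasureTheory.IsFiniteMeasure ν.totalVariation ∧
        ν.totalVariation (QuasiID.lattice M 0 \ {0})ᶜ = 0 ∧
        ν.IntegrableFun QuasiID.stdRep ∧
        QuasiID.drift ν γ ∈ QuasiID.lattice M b) := by
  refine ⟨⟨fun h x _ => h.charFun_ne_zero _, fun h => ?_⟩, fun h => ?_⟩
  · obtain ⟨c, a, ha, -, hca⟩ := QuasiID.exists_charFun_eq_exp hM hμ h
    exact QuasiID.isQuasiInfinitelyDivisible_of_charFun_eq_exp ha hca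
  · obtain ⟨c, a, ha, ha0, hca⟩ :=
      QuasiID.exists_charFun_eq_exp hM hμ fun x _ => h.charFun_ne_zero _
    obtain ⟨ν, γ, ht, hfin, hsupp, hint, hdrift⟩ :=
      QuasiID.exists_isCharTriplet_of_charFun_eq_exp hM ha ha0 hca
    refine ⟨0, ν, γ, ht, fun A' ν' γ' h' => ht.unique h', rfl, hfin, hsupp, hint, ?_⟩
    rw [hdrift]
    -- The drift is Mc + b, with c the winding vector of the torus function F.
    exact ⟨c, rfl⟩
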